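/- Let $(X,\mu)$ be a standard probability space (a standard Borel space $X$ with a Borel probability measure $\mu$) and let $R$ be an equivalence relation on $X$ that is Borel as a subset of $X\times X$ and has countable classes. Let $[[R]]_B$ be the monoid of all partial Borel isomorphisms $g:\operatorname{dom} g\to\operatorname{ran} g$ between Borel subsets of $X$ with $(x,gx)\in R$ for all $x\in\operatorname{dom} g$, with the composition of partial maps $(hg)(x)=h(g(x))$ as product. Assume that $R$ preserves $\mu$, i.e. $\mu(g(A))=\mu(A)$ for all $g\in[[R]]_B$ and all Borel $A\subseteq\operatorname{dom} g$, and that $R$ is aperiodic, i.e. $\mu$-almost every $R$-class is infinite. Let $[[R]]$ be the metric quotient of $[[R]]_B$ under the pseudometric \[d_\mu(g,h)=\mu(\operatorname{dom} g\,\triangle\,\operatorname{dom} h)+\mu\{x\in\operatorname{dom} g\cap\operatorname{dom} h: gx\ne hx\},\] with the induced product, and let the full group $[R]\subseteq[[R]]$, with the metric $d_\mu$, be the image of $\{g\in[[R]]_B:\operatorname{dom} g=\operatorname{ran} g=X\}$. For $N\ge 1$ let $[[N]]$ be the monoid of all partial bijections of $[N]=\{0,\dots,N-1\}$, and let $\mu_\#$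 and $d_\#$ be the normalized counting measure on $[N]$ and the distance on $[[N]]$ defined from it by the same formula; on the symmetric group $\mathfrak S_N$, $d_\#$ is the normalized Hamming distance $d_\#(\sigma,\tau)=\frac1N\#\{i:\sigma(i)\neq\tau(i)\}$. The relation $R$ is called sofic if for every finite $K\subseteq[[R]]$ and every $\varepsilon>0$ there are $N\ge1$ and a map $\pi:[[R]]\to[[N]]$ such that $\pi(\mathrm{id}_X)=\mathrm{id}_{[N]}$ and $\pi(\varnothing)=\varnothing$; $d_\#(\pi(\varphi\psi),\pi(\varphi)\pi(\psi))<\varepsilon$ for all $\varphi,\psi\in K$; and $|\mu\{x:\varphi(x)=x\}-\mu_\#\{m:\pi(\varphi)(m)=m\}|<\varepsilon$ for all $\varphi\in K$. Let $\mathcal U$ be any free ultrafilter on $\mathbb N$. For a sequence $(n_k)_{k\in\mathbb N}$ of positive integers, let $\prod_{\mathcal U}\mathfrak S_{n_k}$ be the metric ultraproduct, i.e. the quotient of the group $\prod_k\mathfrak S_{n_k}$ under the pseudometric $d_{\mathcal U}((\sigma_k),(\tau_k))=\lim_{k\to\mathcal U}d_\#(\sigma_k,\tau_k)$, with the induced metric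 and group structure. Theorem. $R$ is sofic if and only if there are a sequence $(n_k)$ of positive integers and a group homomorphism $\theta:[R]\to\prod_{\mathcal U}\mathfrak S_{n_k}$ that is isometric for $d_\mu$ and $d_{\mathcal U}$. -/

import Mathlib

open MeasureTheory Filter Topology

noncomputable section

namespace SoficRel

universe u

/-! ### Partial Borel isomorphisms and equivalence relations -/

section Relations

variable {X : Type u} [MeasurableSpace X]

/-- A partial bijection `g` of `X`, given as a `PEquiv` (so `g x = some y` when `x ∈ dom g` and
`g x = y`, and `g x = none` when `x ∉ dom g`), is a partial Borel isomorphism if `g⁻¹(B)` and `g(B)`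
are Borel for every Borel set `B`. For `B = X` this says that `dom g` and `ran g` are Borel. -/
def IsPartialBorelIso (g : X ≃. X) : Prop :=
  (∀ B : Set X, MeasurableSet B → MeasurableSet {x | ∃ y ∈ B, y ∈ g x}) ∧
    ∀ B : Set X, MeasurableSet B → MeasurableSet {y | ∃ x ∈ B, y ∈ g x}

/-- `g` is an element of the Borel full semigroup of the relation `r`: a partial Borel isomorphism
with `(x, g x) ∈ r` for all `x ∈ dom g`. -/
def MemBorelFullSemigroup (r : X → X → Prop) (g : X ≃. X) : Prop :=
  IsPartialBorelIso g ∧ ∀ x y, y ∈ g x → r x y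

/-- A countable Borel equivalence relation on `X` which preserves the measure `μ`, that is,
`μ (g(A)) = μ (A)` for all `g` in the Borel full semigroup and all Borel `A ⊆ dom g`. -/
structure MPEquivRel (μ : Measure X) extends Setoid X where
  measurableSet_graph : MeasurableSet {p : X × X | r p.1 p.2}
  countable_class : ∀ x, {y | r x y}.Countable
  measure_image : ∀ g : X ≃. X, MemBorelFullSemigroup r g →
    ∀ A : Set X, MeasurableSet A → A ⊆ {x | (g x).isSome} → μ {y | ∃ x ∈ A, y ∈ g x} = μ A

/-- `R` is aperiodic: almost every class is infinite. -/
def IsAperiodic {μ : Measure X} (R : MPEquivRel μ) : Prop :=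
  ∀ᵐ x ∂μ, {y | R.r x y}.Infinite

theorem IsPartialBorelIso.symm {g : X ≃. X} (hg : IsPartialBorelIso g) :
    IsPartialBorelIso g.symm := by
  refine ⟨fun B hB => ?_, fun B hB => ?_⟩
  · simpa only [PEquiv.mem_iff_mem] using hg.2 B hB
  · simpa only [PEquiv.mem_iff_mem] using hg.1 B hB

theorem IsPartialBorelIso.trans {g h : X ≃. X} (hg : IsPartialBorelIso g)
    (hh : IsPartialBorelIso h) : IsPartialBorelIso (g.trans h) := by
  refine ⟨fun B hB => ?_, fun B hB => ?_⟩
  · convert hg.1 _ (hh.1 B hB) using 1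
    ext x
    simp only [PEquiv.mem_trans, Set.mem_ofPred_eq]
    grind
  · convert hh.2 _ (hg.2 B hB) using 1
    ext x
    simp only [PEquiv.mem_trans, Set.mem_ofPred_eq]
    grind

end Relations

section FullSemigroup

variable {X : Type u} [MeasurableSpace X] {μ : Measure X}

/-- The Borel full semigroup `[[R]]_B`. -/
def BorelFullSemigroup (R : MPEquivRel μ) : Type u :=
  {g : X ≃. X // MemBorelFullSemigroup R.r g}

namespace BorelFullSemigroup

variable {R : MPEquivRel μ}

/-- The domain of `g`. -/
def dom (g : BorelFullSemigroup R) : Set X := {x | (g.1 x).isSome}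

/-- The range of `g`. -/
def ran (g : BorelFullSemigroup R) : Set X := {y | (g.1.symm y).isSome}

/-- The fixed points of `g`. -/
def fix (g : BorelFullSemigroup R) : Set X := {x | x ∈ g.1 x}

/-- The identity map `1_X`. -/
instance : One (BorelFullSemigroup R) :=
  ⟨⟨PEquiv.refl X, ⟨fun B hB => by simpa [PEquiv.refl_apply] using hB,
      fun B hB => by simpa [PEquiv.refl_apply] using hB⟩,
    fun x y h => by
      have : x = y := by simpa [PEquiv.refl_apply] using h
      exact this ▸ R.iseqv.refl x⟩⟩

/-- The empty map. -/
instance : Zero (BorelFullSemigroup R) :=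
  ⟨⟨⊥, ⟨fun B _ => by simp, fun B _ => by simp⟩, fun x y h => by simp at h⟩⟩

/-- The product `h g` is the composition of partial maps: `(h g)(x) = h(g(x))`. -/
instance : Mul (BorelFullSemigroup R) :=
  ⟨fun h g => ⟨g.1.trans h.1, g.2.1.trans h.2.1, fun x z hz => by
    obtain ⟨y, hy, hz⟩ := (PEquiv.mem_trans _ _ _ _).1 hz
    exact R.iseqv.trans (g.2.2 x y hy) (h.2.2 y z hz)⟩⟩

theorem mul_val (h g : BorelFullSemigroup R) : (h * g).1 = g.1.trans h.1 := rfl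

instance : Monoid (BorelFullSemigroup R) where
  mul_assoc a b c := Subtype.ext (PEquiv.trans_assoc c.1 b.1 a.1).symm
  one_mul a := Subtype.ext (PEquiv.trans_refl a.1)
  mul_one a := Subtype.ext (PEquiv.refl_trans a.1)

theorem measurableSet_dom (g : BorelFullSemigroup R) : MeasurableSet g.dom := by
  have := g.2.1.1 Set.univ MeasurableSet.univ
  simpa [dom, Option.isSome_iff_exists] using this

theorem measure_preimage_le (h : BorelFullSemigroup R) (B : Set X) :
    μ {x | ∃ y ∈ B, y ∈ h.1 x} ≤ μ B := by
  set C := toMeasurable μ B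
  have hC : MeasurableSet C := measurableSet_toMeasurable μ B
  have hran : MeasurableSet {y | (h.1.symm y).isSome} := by
    have := h.2.1.2 Set.univ MeasurableSet.univ
    simpa [Option.isSome_iff_exists, PEquiv.mem_iff_mem, ← Option.mem_def] using this
  have key := R.measure_image h.1.symm
    ⟨h.2.1.symm, fun x y hy => R.iseqv.symm (h.2.2 y x ((PEquiv.mem_iff_mem _).1 hy))⟩
    (C ∩ {y | (h.1.symm y).isSome}) (hC.inter hran) Set.inter_subset_right
  calc μ {x | ∃ y ∈ B, y ∈ h.1 x}
      ≤ μ {x | ∃ y ∈ C ∩ {y | (h.1.symm y).isSome}, x ∈ h.1.symm y} := by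
        refine measure_mono ?_
        rintro x ⟨y, hy, hxy⟩
        have hx : x ∈ h.1.symm y := (PEquiv.mem_iff_mem _).2 hxy
        exact ⟨y, ⟨subset_toMeasurable μ B hy, Option.isSome_iff_exists.2 ⟨x, hx⟩⟩, hx⟩
    _ = μ (C ∩ {y | (h.1.symm y).isSome}) := key
    _ ≤ μ C := measure_mono Set.inter_subset_left
    _ = μ B := measure_toMeasurable B

variable [IsProbabilityMeasure μ]

/-- The pseudometric `d_μ`: the measure of the set of those `x` at which exactly one of `g`, `h` is
defined, or both are defined and `g x ≠ h x`; see `dist_eq`. -/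
instance : PseudoMetricSpace (BorelFullSemigroup R) where
  dist g h := μ.real {x | g.1 x ≠ h.1 x}
  dist_self g := by simp
  dist_comm g h := by simp only [ne_comm]
  dist_triangle a b c := by
    refine (measureReal_mono ?_).trans (measureReal_union_le _ _)
    intro x hx
    simp only [Set.mem_ofPred_eq, Set.mem_union] at hx ⊢
    grind

theorem dist_def (g h : BorelFullSemigroup R) : dist g h = μ.real {x | g.1 x ≠ h.1 x} := rfl

theorem dist_eq (g h : BorelFullSemigroup R) :
    dist g h = μ.real (symmDiff g.dom h.dom) +
      μ.real {x | x ∈ g.dom ∩ h.dom ∧ g.1 x ≠ h.1 x} := by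
  have hm : MeasurableSet (symmDiff g.dom h.dom) :=
    (measurableSet_dom g).symmDiff (measurableSet_dom h)
  rw [dist_def, ← measureReal_inter_add_sdiff (s := {x | g.1 x ≠ h.1 x}) hm]
  congr 2
  · ext x
    simp only [Set.mem_inter_iff, Set.mem_ofPred_eq, Set.mem_symmDiff, dom]
    cases g.1 x <;> cases h.1 x <;> simp
  · ext x
    simp only [Set.mem_sdiff, Set.mem_inter_iff, Set.mem_ofPred_eq, Set.mem_symmDiff, dom]
    cases g.1 x <;> cases h.1 x <;> simp

theorem dist_mul_le (g g' h h' : BorelFullSemigroup R) :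
    dist (g * h) (g' * h') ≤ dist g g' + dist h h' := by
  have hle : μ.real {x | ∃ y ∈ {y | g.1 y ≠ g'.1 y}, y ∈ h.1 x} ≤ μ.real {y | g.1 y ≠ g'.1 y} :=
    ENNReal.toReal_mono (measure_ne_top _ _) (measure_preimage_le h _)
  refine le_trans (le_trans (measureReal_mono ?_) (measureReal_union_le
    {x | ∃ y ∈ {y | g.1 y ≠ g'.1 y}, y ∈ h.1 x} {x | h.1 x ≠ h'.1 x})) (by
      rw [dist_def, dist_def]; gcongr)
  intro x hx
  by_cases hh : h.1 x = h'.1 x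
  · left
    have hx : (h.1 x).bind g.1 ≠ (h'.1 x).bind g'.1 := hx
    rw [← hh] at hx
    cases hy : h.1 x with
    | none => simp [hy] at hx
    | some y => exact ⟨y, by simpa [hy] using hx, hy⟩
  · exact Or.inr hh

instance : ContinuousMul (BorelFullSemigroup R) where
  continuous_mul := by
    refine (LipschitzWith.of_dist_le_mul (K := 2) fun p q => ?_).continuous
    refine (dist_mul_le _ _ _ _).trans ?_
    have h1 : dist p.1 q.1 ≤ dist p q := le_max_left _ _
    have h2 : dist p.2 q.2 ≤ dist p q := le_max_right _ _
    push_cast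
    linarith

/-- The trace `μ {x ∈ dom g | g x = x}` at the level of Borel maps. -/
def trace (g : BorelFullSemigroup R) : ℝ := μ.real g.fix

theorem trace_sub_le (g h : BorelFullSemigroup R) : g.trace ≤ h.trace + dist g h := by
  refine (measureReal_mono ?_).trans (measureReal_union_le _ _)
  intro x hx
  by_cases hh : g.1 x = h.1 x
  · left
    simp only [fix, Set.mem_ofPred_eq] at hx ⊢
    rwa [← hh]
  · exact Or.inr hh

theorem trace_congr (g h : BorelFullSemigroup R) (e : Inseparable g h) : g.trace = h.trace := by
  have h0 := Metric.inseparable_iff.1 e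
  refine le_antisymm ?_ ?_
  · simpa [h0] using trace_sub_le g h
  · simpa [h0, dist_comm] using trace_sub_le h g

/-- The Borel full group `[R]_B`: the elements `g` of `[[R]]_B` with `dom g = ran g = X`. -/
def fullGroup (R : MPEquivRel μ) : Submonoid (BorelFullSemigroup R) where
  carrier := {g | g.dom = Set.univ ∧ g.ran = Set.univ}
  one_mem' := by
    constructor <;> ext x <;> simp only [dom, ran, Set.mem_ofPred_eq, Set.mem_univ, iff_true] <;> rfl
  mul_mem' := by
    rintro a b ⟨ha, ha'⟩ ⟨hb, hb'⟩
    simp only [dom, ran, Set.eq_univ_iff_forall, Set.mem_ofPred_eq, Option.isSome_iff_exists]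
      at ha ha' hb hb' ⊢
    refine ⟨fun x => ?_, fun z => ?_⟩
    · obtain ⟨y, hy⟩ := hb x
      obtain ⟨z, hz⟩ := ha y
      exact ⟨z, (PEquiv.mem_trans _ _ _ _).2 ⟨y, hy, hz⟩⟩
    · obtain ⟨y, hy⟩ := ha' z
      obtain ⟨x, hx⟩ := hb' y
      refine ⟨x, ?_⟩
      rw [mul_val, PEquiv.symm_trans_rev]
      exact (PEquiv.mem_trans _ _ _ _).2 ⟨y, hy, hx⟩

end BorelFullSemigroup

variable [IsProbabilityMeasure μ]

/-- The (measured) full semigroup `[[R]]`: the metric quotient of `[[R]]_B` with respect to `d_μ`,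
with the induced metric and the induced product. -/
abbrev FullSemigroup (R : MPEquivRel μ) : Type u := SeparationQuotient (BorelFullSemigroup R)

/-- The trace on `[[R]]`, `tr g = μ {x ∈ dom g | g x = x}`. -/
def FullSemigroup.trace {R : MPEquivRel μ} : FullSemigroup R → ℝ :=
  SeparationQuotient.lift BorelFullSemigroup.trace BorelFullSemigroup.trace_congr

/-- The (measured) full group `[R]`: the image of `[R]_B` in `[[R]]`, with the product and the
metric of `[[R]]`. On it the metric is `d_μ(g, h) = μ {x | g x ≠ h x}`. -/
def FullGroup (R : MPEquivRel μ) : Submonoid (FullSemigroup R) :=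
  (BorelFullSemigroup.fullGroup R).map SeparationQuotient.mkMonoidHom

end FullSemigroup

/-! ### Hamming distances and soficity -/

/-- The normalized Hamming distance `#{i | x i ≠ y i} / N` between two functions on `Fin N`.
It is used for partial bijections of `Fin N` (functions to `Option (Fin N)`, where `none` stands for
"undefined") and for permutations of `Fin N`. -/
def normHamming {N : ℕ} {β : Type} [DecidableEq β] (x y : Fin N → β) : ℝ :=
  (hammingDist x y : ℝ) / N

/-- The normalized trace `#{m ∈ dom f | f m = m} / N` of a partial bijection of `Fin N`. -/
def finTrace {N : ℕ} (f : Fin N ≃. Fin N) : ℝ :=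
  (Nat.card {m : Fin N // m ∈ f m} : ℝ) / N

/-- Soficity: for every finite `K ⊆ [[R]]` and `ε > 0` there is a `(K, ε)`-almost morphism from
`[[R]]` to the semigroup `[[N]]` of partial bijections of an `N`-element set. Recall that
`f.trans g` is the map `x ↦ g (f x)`. -/
def IsSofic {X : Type u} [MeasurableSpace X] {μ : Measure X} [IsProbabilityMeasure μ]
    (R : MPEquivRel μ) : Prop :=
  ∀ (K : Finset (FullSemigroup R)) (ε : ℝ), 0 < ε →
    ∃ N : ℕ, 0 < N ∧ ∃ π : FullSemigroup R → (Fin N ≃. Fin N),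
      π 1 = PEquiv.refl (Fin N) ∧
      π (SeparationQuotient.mk 0) = ⊥ ∧
      (∀ φ ∈ K, ∀ ψ ∈ K, normHamming (π (φ * ψ)) ((π ψ).trans (π φ)) < ε) ∧
      ∀ φ ∈ K, |FullSemigroup.trace φ - finTrace (π φ)| < ε

/-! ### Metric ultraproducts of symmetric groups -/

/-- The product `∏ₖ 𝔖_{nₖ}`, tagged with an ultrafilter `U` on `ℕ` so that it can carry the
pseudometric `d_U`. -/
def SymProd (_U : Ultrafilter ℕ) (n : ℕ → ℕ) : Type := ∀ k, Equiv.Perm (Fin (n k))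

namespace SymProd

variable {U : Ultrafilter ℕ} {n : ℕ → ℕ}

/-- Coordinatewise group structure. -/
instance : Group (SymProd U n) := inferInstanceAs (Group (∀ k, Equiv.Perm (Fin (n k))))

/-- The sequence of normalized Hamming distances `d_#(xₖ, yₖ)`. -/
def distSeq (x y : SymProd U n) (k : ℕ) : ℝ := normHamming (⇑(x k)) (⇑(y k))

theorem distSeq_mem (x y : SymProd U n) (k : ℕ) : distSeq x y k ∈ Set.Icc (0 : ℝ) 1 := by
  refine ⟨by unfold distSeq normHamming; positivity, div_le_one_of_le₀ ?_ (by positivity)⟩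
  have := hammingDist_le_card_fintype (x := ⇑(x k)) (y := ⇑(y k))
  rw [Fintype.card_fin] at this
  exact_mod_cast this

theorem tendsto_distSeq (x y : SymProd U n) :
    Tendsto (distSeq x y) U (𝓝 (limUnder (U : Filter ℕ) (distSeq x y))) := by
  apply tendsto_nhds_limUnder
  have h : ((U.map (distSeq x y) : Ultrafilter ℝ) : Filter ℝ) ≤ 𝓟 (Set.Icc (0 : ℝ) 1) := by
    rw [le_principal_iff, Ultrafilter.coe_map, mem_map]
    exact Filter.mem_of_superset univ_mem fun k _ => distSeq_mem x y k
  obtain ⟨a, -, ha⟩ := isCompact_Icc.ultrafilter_le_nhds _ h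
  exact ⟨a, ha⟩

/-- The pseudometric `d_U(x, y) = lim_{k → U} d_#(xₖ, yₖ)`; the limit exists by `tendsto_distSeq`. -/
instance : PseudoMetricSpace (SymProd U n) where
  dist x y := limUnder (U : Filter ℕ) (distSeq x y)
  dist_self x := by
    refine tendsto_nhds_unique (tendsto_distSeq x x) ?_
    have : distSeq x x = fun _ => 0 := by ext k; simp [distSeq, normHamming]
    rw [this]
    exact tendsto_const_nhds
  dist_comm x y := by
    have : distSeq x y = distSeq y x := by
      ext k; simp only [distSeq, normHamming, hammingDist_comm]
    rw [this]
  dist_triangle x y z := by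
    refine le_of_tendsto_of_tendsto' (tendsto_distSeq x z)
      ((tendsto_distSeq x y).add (tendsto_distSeq y z)) fun k => ?_
    simp only [distSeq, normHamming, ← add_div]
    gcongr
    exact_mod_cast hammingDist_triangle _ _ _

theorem tendsto_dist (x y : SymProd U n) : Tendsto (distSeq x y) U (𝓝 (dist x y)) :=
  tendsto_distSeq x y

theorem distSeq_mul_left (a x y : SymProd U n) : distSeq (a * x) (a * y) = distSeq x y := by
  ext k
  simp only [distSeq, normHamming]
  congr 2
  exact hammingDist_comp (fun _ => a k) fun _ => (a k).injective

theorem distSeq_mul_right (a x y : SymProd U n) : distSeq (x * a) (y * a) = distSeq x y := by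
  ext k
  simp only [distSeq, normHamming]
  congr 2
  refine Finset.card_bij (fun i _ => a k i) (fun i hi => ?_) (fun i _ j _ h => (a k).injective h)
    fun j hj => ⟨(a k).symm j, ?_, by simp⟩
  · have : ∀ b : SymProd U n, (b * a) k i = b k (a k i) := fun b => rfl
    simpa [this] using hi
  · have : ∀ b : SymProd U n, (b * a) k ((a k).symm j) = b k j := fun b =>
      congrArg (b k) ((a k).apply_symm_apply j)
    simpa [this] using hj

theorem dist_mul_left' (a x y : SymProd U n) : dist (a * x) (a * y) = dist x y :=
  congrArg (limUnder (U : Filter ℕ)) (distSeq_mul_left a x y)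

theorem dist_mul_right' (a x y : SymProd U n) : dist (x * a) (y * a) = dist x y :=
  congrArg (limUnder (U : Filter ℕ)) (distSeq_mul_right a x y)

instance : IsTopologicalGroup (SymProd U n) where
  continuous_mul := by
    refine (LipschitzWith.of_dist_le_mul (K := 2) fun p q => ?_).continuous
    have h0 := dist_triangle (p.1 * p.2) (p.1 * q.2) (q.1 * q.2)
    rw [dist_mul_left', dist_mul_right'] at h0
    have h1 : dist p.1 q.1 ≤ dist p q := le_max_left _ _
    have h2 : dist p.2 q.2 ≤ dist p q := le_max_right _ _
    push_cast
    linarith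
  continuous_inv := by
    refine (Isometry.of_dist_eq fun x y => ?_).continuous
    rw [← dist_mul_left' x, ← dist_mul_right' y]
    simp [dist_comm]

end SymProd

/-- The metric ultraproduct `∏_U 𝔖_{nₖ}`: the metric quotient of `∏ₖ 𝔖_{nₖ}` with respect to the
pseudometric `d_U`, with the induced metric and group structure. -/
abbrev SymUltraproduct (U : Ultrafilter ℕ) (n : ℕ → ℕ) : Type :=
  SeparationQuotient (SymProd U n)

end SoficRel

end

/-! Suppose `R` is sofic. On the full group, `d_μ(g, h) = 1 - tr(g⁻¹h)`, so a map that almost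
respects products and traces is almost isometric there. Since `π(g⁻¹)π(g)` is almost the identity,
the partial bijection `π(g)` is almost everywhere defined and extends at small cost to a permutation
(`IsSofic.exists_perm`). As `[R]` is separable (`BorelAut.exists_denseSeq`), a diagonal choice along
the ultrafilter turns these almost homomorphisms into `θ`.

For the converse, `[[R]]` with its partial identities has to be recovered from `[R]`. An isometric
`θ` preserves the size of supports. If `g` and `h` have disjoint supports, the sizes for `g` and `h`
add up to that for `gh`, which forces their images to have asymptotically disjoint supports
(`eventually_act_eq_or`). By aperiodicity every Borel set `A` is, up to a null set, the support of
an involution in `[R]` (`IsAperiodic.exists_support`); the support of its image is a copy of `A` in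
the finite sets, called `region A`. Modulo density zero, the regions respect measure, Boolean
operations and the action of `[R]`. A simple element of `[[R]]` is pieced together from finitely
many elements of `[R]` on Borel sets, so the corresponding permutations can be pieced together on
the regions. This preserves products (`Follows.trans`) and distances (`hasDensity_ne`). Simple
elements are dense, and a single index `k` in a suitable set of the ultrafilter gives the almost
morphism.

Both directions need countably many involutions generating `R` almost everywhere. These come from a
measure-theoretic Lusin-Novikov theorem, proved by an exhaustion argument that rests on the
measurability of analytic sets and on Baire's theorem. -/

namespace SoficRel

/-! ### Measurability of analytic sets -/

section Analytic

variable {X : Type*} [MeasurableSpace X] {μ : Measure X}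

/-- Continuity from below holds for the outer measure of arbitrary increasing sets, so the images
need not be measurable. -/
theorem exists_le_and_lt_measure_image {f : (ℕ → ℕ) → X} {c : ENNReal} {S : Set (ℕ → ℕ)} (i : ℕ)
    (h : c < μ (f '' S)) : ∃ m : ℕ, c < μ (f '' (S ∩ {x | x i ≤ m})) := by
  have hU : f '' S = ⋃ m : ℕ, f '' (S ∩ {x | x i ≤ m}) := by
    rw [← Set.image_iUnion, ← Set.inter_iUnion]
    congr 1
    refine (Set.inter_eq_left.2 fun x _ => Set.mem_iUnion.2 ⟨x i, ?_⟩).symm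
    exact le_refl (x i)
  have hm : Monotone fun m : ℕ => f '' (S ∩ {x | x i ≤ m}) := fun a b hab =>
    Set.image_mono (Set.inter_subset_inter_right _ fun x (hx : x i ≤ a) => hx.trans hab)
  rw [hU, hm.measure_iUnion] at h
  exact lt_iSup_iff.1 h

/-- The coordinates are bounded one after the other, each time keeping the outer measure above `c`.
Passing to the limit, with all coordinates bounded, requires compactness. -/
theorem exists_bound_lt_measure_image {f : (ℕ → ℕ) → X} {c : ENNReal} (h : c < μ (Set.range f)) :
    ∃ b : ℕ → ℕ, ∀ i, c < μ (f '' {x | ∀ j < i, x j ≤ b j}) := by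
  choose m hm using fun (i : ℕ) (S : {S : Set (ℕ → ℕ) // c < μ (f '' S)}) =>
    exists_le_and_lt_measure_image i S.2
  let S : ℕ → {S : Set (ℕ → ℕ) // c < μ (f '' S)} := fun i =>
    Nat.rec ⟨Set.univ, by rwa [Set.image_univ]⟩ (fun i S => ⟨S.1 ∩ {x | x i ≤ m i S}, hm i S⟩) i
  refine ⟨fun i => m i (S i), fun i => ?_⟩
  have hS : (S i).1 = {x | ∀ j < i, x j ≤ m j (S j)} := by
    induction i with
    | zero => simp [S]
    | succ i ih =>
      change (S i).1 ∩ {x | x i ≤ m i (S i)} = _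
      rw [ih]
      ext x
      simp only [Set.mem_inter_iff, Set.mem_ofPred_eq, Nat.lt_succ_iff_lt_or_eq]
      grind
  rw [← hS]
  exact (S i).2

theorem isCompact_setOf_forall_le (b : ℕ → ℕ) : IsCompact {x : ℕ → ℕ | ∀ j, x j ≤ b j} := by
  have : {x : ℕ → ℕ | ∀ j, x j ≤ b j} = Set.univ.pi fun j => Set.Iic (b j) := by
    ext x; simp [Pi.le_def]
  rw [this]
  exact isCompact_univ_pi fun j => (Set.finite_Iic (b j)).isCompact

/-- Otherwise there are points outside `W` satisfying more and more of the bounds. Truncating them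
to the compact box changes no fixed coordinate in the long run, so a subsequence converges to a
point of the box, hence of `W`. -/
theorem exists_forall_lt_le_subset {W : Set (ℕ → ℕ)} (hW : IsOpen W) (b : ℕ → ℕ)
    (h : {x | ∀ j, x j ≤ b j} ⊆ W) : ∃ i, {x : ℕ → ℕ | ∀ j < i, x j ≤ b j} ⊆ W := by
  by_contra! hcon
  choose x hx hxW using fun i => Set.not_subset.1 (hcon i)
  obtain ⟨a, ha, φ, hφ, hlim⟩ := (isCompact_setOf_forall_le b).tendsto_subseq
    (x := fun i j => min (x i j) (b j)) fun i j => min_le_right _ _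
  have hlim' : Tendsto (x ∘ φ) atTop (𝓝 a) := by
    rw [tendsto_pi_nhds] at hlim ⊢
    intro j
    refine (hlim j).congr' ?_
    filter_upwards [eventually_gt_atTop j] with i hi
    exact min_eq_left (hx (φ i) j (hi.trans_le (hφ.id_le i)))
  obtain ⟨i, hi⟩ := (hlim'.eventually (hW.mem_nhds (h ha))).exists
  exact hxW _ hi

/-- Choquet's capacitability argument: `K` is the image of the box. An open set around `K` of
measure below `c` would contain the image of a set with only finitely many bounded coordinates,
whose outer measure exceeds `c`. -/
theorem exists_isCompact_of_lt_measure_range [TopologicalSpace X] [μ.OuterRegular]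
    {f : (ℕ → ℕ) → X} (hf : Continuous f) {c : ENNReal} (hc : c < μ (Set.range f)) :
    ∃ K ⊆ Set.range f, IsCompact K ∧ c ≤ μ K := by
  obtain ⟨b, hb⟩ := exists_bound_lt_measure_image hc
  refine ⟨f '' {x | ∀ j, x j ≤ b j}, Set.image_subset_range _ _,
    (isCompact_setOf_forall_le b).image hf, ?_⟩
  by_contra! hlt
  obtain ⟨V, hKV, hV, hVc⟩ := Set.exists_isOpen_lt_of_lt _ _ hlt
  obtain ⟨i, hi⟩ := exists_forall_lt_le_subset (hV.preimage hf) b (Set.image_subset_iff.1 hKV)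
  exact (hb i).not_ge ((measure_mono (Set.image_subset_iff.2 hi)).trans hVc.le)

theorem nullMeasurableSet_of_forall_lt [IsFiniteMeasure μ] {S : Set X}
    (h : ∀ c < μ S, ∃ K ⊆ S, MeasurableSet K ∧ c ≤ μ K) : NullMeasurableSet S μ := by
  rcases eq_or_ne (μ S) 0 with h0 | h0
  · exact NullMeasurableSet.of_null h0
  obtain ⟨c, -, hc, hlim⟩ := exists_seq_strictMono_tendsto' (pos_iff_ne_zero.2 h0)
  choose K hKS hK hcK using fun n => h (c n) (hc n).2
  have hle : μ S ≤ μ (⋃ n, K n) := le_of_tendsto' hlim fun n =>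
    (hcK n).trans (measure_mono (Set.subset_iUnion K n))
  have hae : (⋃ n, K n) =ᵐ[μ] S :=
    ae_eq_of_subset_of_measure_ge (Set.iUnion_subset hKS) hle
      (MeasurableSet.iUnion hK).nullMeasurableSet (measure_ne_top _ _)
  exact (MeasurableSet.iUnion hK).nullMeasurableSet.congr hae

theorem nullMeasurableSet_of_analyticSet [TopologicalSpace X] [T2Space X] [OpensMeasurableSpace X]
    [IsFiniteMeasure μ] [μ.OuterRegular] {S : Set X} (hS : AnalyticSet S) :
    NullMeasurableSet S μ := by
  rw [AnalyticSet] at hS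
  rcases hS with rfl | ⟨f, hf, rfl⟩
  · exact MeasurableSet.empty.nullMeasurableSet
  · refine nullMeasurableSet_of_forall_lt fun c hc => ?_
    obtain ⟨K, hK, hKc, hcK⟩ := exists_isCompact_of_lt_measure_range hf hc
    exact ⟨K, hK, hKc.measurableSet, hcK⟩

end Analytic

/-- The image of a Borel set under a Borel map is measurable up to a null set. -/
theorem nullMeasurableSet_image {E X : Type*} [MeasurableSpace E] [StandardBorelSpace E]
    [MeasurableSpace X] [StandardBorelSpace X] (ν : Measure X) [IsFiniteMeasure ν] {p : E → X}
    (hp : Measurable p) {S : Set E} (hS : MeasurableSet S) : NullMeasurableSet (p '' S) ν := by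
  let _ := upgradeStandardBorel X
  exact nullMeasurableSet_of_analyticSet (hS.analyticSet_image hp)

/-! ### Borel maps with countable fibres -/

/-- The closure of `G` is a countable Polish space, so by Baire it has an isolated point, and an
isolated point of the closure lies in `G`. -/
theorem exists_isOpen_inter_eq_singleton {E : Type*} [TopologicalSpace E] [PolishSpace E]
    {G F : Set E} (hF : IsClosed F) (hFc : F.Countable) (hGF : G ⊆ F) (hG : G.Nonempty) :
    ∃ z, ∃ U : Set E, IsOpen U ∧ G ∩ U = {z} := by
  have hKF : closure G ⊆ F := hF.closure_subset_iff.2 hGF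
  have hK : IsClosed (closure G) := isClosed_closure
  have : PolishSpace (closure G) := hK.polishSpace
  have : Countable (closure G) := (hFc.mono hKF).to_subtype
  have : Nonempty (closure G) := hG.closure.to_subtype
  obtain ⟨z, hz⟩ := nonempty_interior_of_iUnion_of_closed (X := closure G)
    (f := fun z : closure G => {z}) (fun z => isClosed_singleton) (by ext; simp)
  have hop : IsOpen ({z} : Set (closure G)) := by
    have : interior ({z} : Set (closure G)) = {z} :=
      (Set.subset_singleton_iff_eq.1 interior_subset).resolve_left hz.ne_empty
    rw [← this]
    exact isOpen_interior
  obtain ⟨U, hU, hUz⟩ := isOpen_induced_iff.1 hop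
  have hzU : z.1 ∈ U := by
    have : z ∈ (Subtype.val ⁻¹' U : Set (closure G)) := by rw [hUz]; rfl
    exact this
  obtain ⟨w, hwU, hwG⟩ := mem_closure_iff.1 z.2 U hU hzU
  have huniq : ∀ v ∈ G, v ∈ U → v = z.1 := fun v hv hvU => by
    have : (⟨v, subset_closure hv⟩ : closure G) ∈ (Subtype.val ⁻¹' U : Set (closure G)) := hvU
    rw [hUz] at this
    exact congrArg Subtype.val this
  refine ⟨z.1, U, hU, Set.eq_singleton_iff_unique_mem.2 ⟨?_, fun v hv => huniq v hv.1 hv.2⟩⟩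
  rw [← huniq w hwG hwU]
  exact ⟨hwG, hwU⟩

/-! ### Lusin-Novikov up to null sets, by exhaustion -/

section LusinNovikov

variable {E X : Type*} [MeasurableSpace E]

/-- `S` is a countable union of Borel sets on each of which `p` is injective. -/
def IsCountablyInjOn (p : E → X) (S : Set E) : Prop :=
  ∃ B : ℕ → Set E, (∀ n, MeasurableSet (B n)) ∧ (∀ n, Set.InjOn p (B n)) ∧ S = ⋃ n, B n

theorem IsCountablyInjOn.measurableSet {p : E → X} {S : Set E} (h : IsCountablyInjOn p S) :
    MeasurableSet S := by
  obtain ⟨B, hB, -, rfl⟩ := h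
  exact MeasurableSet.iUnion hB

theorem IsCountablyInjOn.iUnion {p : E → X} {S : ℕ → Set E} (h : ∀ n, IsCountablyInjOn p (S n)) :
    IsCountablyInjOn p (⋃ n, S n) := by
  choose B hB hinj hS using h
  refine ⟨fun k => B k.unpair.1 k.unpair.2, fun k => hB _ _, fun k => hinj _ _, ?_⟩
  simp only [hS]
  exact (Set.iUnion_unpair B).symm

theorem IsCountablyInjOn.of_injOn {p : E → X} {S : Set E} (hS : MeasurableSet S)
    (h : Set.InjOn p S) : IsCountablyInjOn p S :=
  ⟨fun _ => S, fun _ => hS, fun _ => h, (Set.iUnion_const S).symm⟩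

theorem IsCountablyInjOn.union {p : E → X} {S T : Set E} (hS : IsCountablyInjOn p S)
    (hT : IsCountablyInjOn p T) : IsCountablyInjOn p (S ∪ T) := by
  have : S ∪ T = ⋃ n : ℕ, if n = 0 then S else T := by
    ext x
    simp only [Set.mem_union, Set.mem_iUnion]
    constructor
    · rintro (h | h)
      · exact ⟨0, by simpa⟩
      · exact ⟨1, by simpa⟩
    · rintro ⟨n, hn⟩
      split_ifs at hn <;> tauto
  rw [this]
  refine IsCountablyInjOn.iUnion fun n => ?_
  split_ifs <;> assumption

variable [MeasurableSpace X]

/-- Some countably injective set leaves a remainder whose image in `X` is as small as possible,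
simultaneously for the remainders in countably many sets `U n`. -/
theorem exists_isCountablyInjOn_minimal (ν : Measure X) (p : E → X) (U : ℕ → Set E) :
    ∃ S, IsCountablyInjOn p S ∧ ∀ T, IsCountablyInjOn p T → ∀ n,
      ν (p '' (U n \ S)) ≤ ν (p '' (U n \ T)) := by
  have hempty : IsCountablyInjOn p (∅ : Set E) :=
    IsCountablyInjOn.of_injOn MeasurableSet.empty (Set.injOn_empty p)
  have key : ∀ n, ∃ S, IsCountablyInjOn p S ∧ ∀ T, IsCountablyInjOn p T →
      ν (p '' (U n \ S)) ≤ ν (p '' (U n \ T)) := fun n => by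
    set V : Set ENNReal := {a | ∃ T, IsCountablyInjOn p T ∧ a = ν (p '' (U n \ T))}
    obtain ⟨u, -, hlim, hu⟩ := exists_seq_tendsto_sInf (S := V) ⟨_, ∅, hempty, rfl⟩
      (OrderBot.bddBelow V)
    choose T hT huT using hu
    refine ⟨⋃ k, T k, IsCountablyInjOn.iUnion hT, fun T' hT' => ?_⟩
    refine le_trans (ge_of_tendsto' hlim fun k => ?_) (sInf_le ⟨T', hT', rfl⟩)
    rw [huT k]
    exact measure_mono (Set.image_mono (Set.sdiff_subset_sdiff_right (Set.subset_iUnion T k)))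
  choose S hS hmin using key
  refine ⟨⋃ n, S n, IsCountablyInjOn.iUnion hS, fun T hT n => ?_⟩
  exact (measure_mono (Set.image_mono (Set.sdiff_subset_sdiff_right
    (Set.subset_iUnion S n)))).trans (hmin n T hT)

/-- Over the points with a one-point remaining fibre, `p` is injective on `U \ S`. If these points
had positive measure, adding that part to `S` would contradict minimality. -/
theorem ae_fiber_diff_ne_singleton [StandardBorelSpace E] [StandardBorelSpace X] (ν : Measure X)
    [IsFiniteMeasure ν] {p : E → X} (hp : Measurable p) {S U : Set E} (hS : IsCountablyInjOn p S)
    (hU : MeasurableSet U)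
    (hmin : ∀ T, IsCountablyInjOn p T → ν (p '' (U \ S)) ≤ ν (p '' (U \ T))) :
    ∀ᵐ x ∂ν, ∀ z, p ⁻¹' {x} ∩ (U \ S) ≠ {z} := by
  obtain ⟨V, hV, hVsep⟩ := MeasurableSpace.CountablySeparated.countably_separated (α := E)
    |>.exists_countable_separating
  obtain ⟨hVm, hVs⟩ := hVsep
  set G := U \ S with hG
  have hGm : MeasurableSet G := hU.diff hS.measurableSet
  -- `C` consists of the points with exactly one preimage in `G`, because two distinct preimages are
  -- separated by some `W ∈ V`. It is built from images of Borel sets, hence null measurable.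
  set C : Set X := p '' G \ ⋃ W ∈ V, p '' (G ∩ W) ∩ p '' (G \ W) with hCdef
  have hC : NullMeasurableSet C ν :=
    (nullMeasurableSet_image ν hp hGm).diff (NullMeasurableSet.biUnion hV fun W hW =>
      (nullMeasurableSet_image ν hp (hGm.inter (hVm W hW))).inter
        (nullMeasurableSet_image ν hp (hGm.diff (hVm W hW))))
  obtain ⟨C', hC'C, hC'm, hC'ae⟩ := hC.exists_measurable_subset_ae_eq
  have hinj : Set.InjOn p (G ∩ p ⁻¹' C') := by
    rintro a ⟨haG, haC⟩ b ⟨hbG, hbC⟩ hab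
    refine hVs a (Set.mem_univ _) b (Set.mem_univ _) fun W hW => ?_
    have hn := (hC'C haC).2
    simp only [Set.mem_iUnion, not_exists] at hn
    have hn := hn W hW
    constructor
    · intro h
      by_contra h'
      exact hn ⟨⟨a, ⟨haG, h⟩, rfl⟩, ⟨b, ⟨hbG, h'⟩, hab.symm⟩⟩
    · intro h
      by_contra h'
      exact hn ⟨⟨b, ⟨hbG, h⟩, hab.symm⟩, ⟨a, ⟨haG, h'⟩, rfl⟩⟩
  have hT := hS.union (IsCountablyInjOn.of_injOn (hGm.inter (hp hC'm)) hinj)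
  have himg : p '' (U \ (S ∪ G ∩ p ⁻¹' C')) = p '' G \ C' := by
    ext x
    constructor
    · rintro ⟨e, ⟨heU, heS⟩, rfl⟩
      have h1 : e ∉ S := fun h => heS (Or.inl h)
      exact ⟨⟨e, ⟨heU, h1⟩, rfl⟩, fun h => heS (Or.inr ⟨⟨heU, h1⟩, h⟩)⟩
    · rintro ⟨⟨e, he, rfl⟩, h⟩
      refine ⟨e, ⟨he.1, ?_⟩, rfl⟩
      rintro (h' | h')
      exacts [he.2 h', h h'.2]
  have hle := hmin _ hT
  rw [himg, measure_sdiff (hC'C.trans Set.sdiff_subset) hC'm.nullMeasurableSet (measure_ne_top _ _)]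
    at hle
  have hC'0 : ν C' = 0 := by
    by_contra h0
    exact hle.not_gt (ENNReal.sub_lt_self (measure_ne_top _ _)
      (ne_of_gt (lt_of_lt_of_le (pos_iff_ne_zero.2 h0)
        (measure_mono (hC'C.trans Set.sdiff_subset)))) h0)
  have hC0 : ν C = 0 := by rw [← measure_congr hC'ae, hC'0]
  filter_upwards [measure_eq_zero_iff_ae_notMem.1 hC0] with x hx z hz
  have hz' : z ∈ p ⁻¹' {x} ∩ G := by rw [hz]; rfl
  refine hx ⟨⟨z, hz'.2, hz'.1⟩, ?_⟩
  simp only [Set.mem_iUnion, not_exists]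
  rintro W hW ⟨⟨a, ha, hax⟩, b, hb, hbx⟩
  have ha' : a ∈ p ⁻¹' {x} ∩ G := ⟨hax, ha.1⟩
  have hb' : b ∈ p ⁻¹' {x} ∩ G := ⟨hbx, hb.1⟩
  rw [hz] at ha' hb'
  exact hb.2 (by rw [Set.mem_singleton_iff.1 hb', ← Set.mem_singleton_iff.1 ha']; exact ha.2)

/-- A fibre not covered by `S` leaves a nonempty subset of a countable closed set. This subset has
an isolated point, so some basic open `U n` cuts it down to a singleton, which is excluded almost
everywhere by minimality. -/
theorem exists_isCountablyInjOn_ae_of_continuous [TopologicalSpace E] [PolishSpace E]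
    [BorelSpace E] [TopologicalSpace X] [PolishSpace X] [BorelSpace X] (ν : Measure X)
    [IsFiniteMeasure ν] {p : E → X} (hp : Continuous p) (hc : ∀ x, (p ⁻¹' {x}).Countable) :
    ∃ S, IsCountablyInjOn p S ∧ ∀ᵐ x ∂ν, p ⁻¹' {x} ⊆ S := by
  obtain ⟨b, hbc, -, hb⟩ := TopologicalSpace.exists_countable_basis E
  obtain ⟨U, hU⟩ := (hbc.insert ∅).exists_eq_range (Set.insert_nonempty _ _)
  obtain ⟨S, hS, hmin⟩ := exists_isCountablyInjOn_minimal ν p U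
  have hUo : ∀ n, IsOpen (U n) := fun n => by
    have : U n ∈ insert ∅ b := hU ▸ Set.mem_range_self n
    rcases this with h | h
    · rw [h]
      exact isOpen_empty
    · exact hb.isOpen h
  refine ⟨S, hS, ?_⟩
  have hae := ae_all_iff.2 fun n => ae_fiber_diff_ne_singleton ν hp.measurable hS
    (hUo n).measurableSet fun T hT => hmin T hT n
  filter_upwards [hae] with x hx
  by_contra hsub
  obtain ⟨e, he, heS⟩ := Set.not_subset.1 hsub
  obtain ⟨z, O, hO, hOz⟩ := exists_isOpen_inter_eq_singleton (G := p ⁻¹' {x} \ S)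
    (isClosed_singleton.preimage hp) (hc x) Set.sdiff_subset ⟨e, he, heS⟩
  have hz : z ∈ (p ⁻¹' {x} \ S) ∩ O := by rw [hOz]; rfl
  obtain ⟨W, hW, hzW, hWO⟩ := hb.exists_subset_of_mem_open hz.2 hO
  have hW := Set.mem_insert_of_mem ∅ hW
  rw [hU] at hW
  obtain ⟨n, rfl⟩ := hW
  refine hx n z (Set.eq_singleton_iff_unique_mem.2 ⟨⟨hz.1.1, hzW, hz.1.2⟩, ?_⟩)
  rintro w ⟨hwx, hwU, hwS⟩
  have : w ∈ (p ⁻¹' {x} \ S) ∩ O := ⟨⟨hwx, hwS⟩, hWO hwU⟩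
  rwa [hOz] at this

/-- A measure-theoretic form of the Lusin-Novikov theorem: over almost every point, the domain of a
Borel map with countable fibres is covered by countably many Borel sets on which it is injective. -/
theorem exists_isCountablyInjOn_ae [StandardBorelSpace E] [StandardBorelSpace X] (ν : Measure X)
    [IsFiniteMeasure ν] {p : E → X} (hp : Measurable p) (hc : ∀ x, (p ⁻¹' {x}).Countable) :
    ∃ S, IsCountablyInjOn p S ∧ ∀ᵐ x ∂ν, p ⁻¹' {x} ⊆ S := by
  let _ := upgradeStandardBorel X
  obtain ⟨t, hbt, hPt⟩ := StandardBorelSpace.polish (α := E)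
  -- A finer Polish topology makes `p` continuous without changing the Borel sets.
  obtain ⟨t', ht', hpt, hPt'⟩ := hp.exists_continuous
  have hborel : @BorelSpace E t' _ := by
    refine @BorelSpace.mk E t' _ ?_
    rw [borel_eq_borel_of_le hPt' hPt ht']
    exact hbt.measurable_eq
  exact exists_isCountablyInjOn_ae_of_continuous ν hpt hc

end LusinNovikov

/-! ### Covering a Borel relation by graphs of partial injections -/

section GraphCover

variable {X : Type*} [MeasurableSpace X] [StandardBorelSpace X]

theorem ae_of_ae_map_comap {E : Type*} [MeasurableSpace E] [StandardBorelSpace E] (μ : Measure X)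
    {p q : E → X} (hp : Measurable p) (hq : Measurable q) {B : Set E} (hB : MeasurableSet B)
    (hinj : Set.InjOn p B) {P : X → Prop}
    (h : ∀ᵐ y ∂((μ.comap fun b : B => p b).map fun b : B => q b), P y) :
    ∀ᵐ x ∂μ, ∀ b ∈ B, p b = x → P (q b) := by
  have := hB.standardBorel
  have hι : MeasurableEmbedding fun b : B => p b :=
    (hp.comp measurable_subtype_coe).measurableEmbedding hinj.injective
  have h1 : ∀ᵐ b : B ∂(μ.comap fun b : B => p b), P (q b) :=
    ae_of_ae_map (hq.comp measurable_subtype_coe).aemeasurable h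
  rw [ae_iff, hι.comap_apply] at h1
  filter_upwards [measure_eq_zero_iff_ae_notMem.1 h1] with x hx b hb hbx
  by_contra hP
  exact hx ⟨⟨b, hb⟩, hP, hbx⟩

/-- A Borel set with countable sections is, over almost every point, a countable union of graphs of
injective partial Borel functions. -/
theorem exists_cover_injOn_fst_snd (μ : Measure X) [IsFiniteMeasure μ] {Γ : Set (X × X)}
    (hΓ : MeasurableSet Γ) (h1 : ∀ x, {y | (x, y) ∈ Γ}.Countable)
    (h2 : ∀ y, {x | (x, y) ∈ Γ}.Countable) :
    ∃ B : ℕ → Set (X × X), (∀ n, MeasurableSet (B n)) ∧ (∀ n, B n ⊆ Γ) ∧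
      (∀ n, Set.InjOn Prod.fst (B n)) ∧ (∀ n, Set.InjOn Prod.snd (B n)) ∧
      ∀ᵐ x ∂μ, ∀ y, (x, y) ∈ Γ → ∃ n, (x, y) ∈ B n := by
  have := hΓ.standardBorel
  have hp : Measurable fun e : Γ => e.1.1 := measurable_fst.comp measurable_subtype_coe
  have hq : Measurable fun e : Γ => e.1.2 := measurable_snd.comp measurable_subtype_coe
  have hpc : ∀ x, ((fun e : Γ => e.1.1) ⁻¹' {x}).Countable := fun x => by
    refine Set.MapsTo.countable_of_injOn (f := fun e : Γ => e.1.2) (t := {y | (x, y) ∈ Γ}) ?_ ?_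
      (h1 x)
    · rintro ⟨⟨a, b⟩, hab⟩ (rfl : a = x)
      exact hab
    · rintro ⟨⟨a, b⟩, hab⟩ (rfl : a = x) ⟨⟨a', b'⟩, hab'⟩ (rfl : a' = a) (h : b = b')
      subst h
      rfl
  have hqc : ∀ y, ((fun e : Γ => e.1.2) ⁻¹' {y}).Countable := fun y => by
    refine Set.MapsTo.countable_of_injOn (f := fun e : Γ => e.1.1) (t := {x | (x, y) ∈ Γ}) ?_ ?_
      (h2 y)
    · rintro ⟨⟨a, b⟩, hab⟩ (rfl : b = y)
      exact hab
    · rintro ⟨⟨a, b⟩, hab⟩ (rfl : b = y) ⟨⟨a', b'⟩, hab'⟩ (rfl : b' = b) (h : a = a')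
      subst h
      rfl
  obtain ⟨S, ⟨B, hB, hBinj, rfl⟩, hS⟩ := exists_isCountablyInjOn_ae μ hp hpc
  have hfin : ∀ n, IsFiniteMeasure (μ.comap fun b : B n => b.1.1.1) := fun n => by
    have := (hB n).standardBorel
    have hι : MeasurableEmbedding fun b : B n => b.1.1.1 :=
      (hp.comp measurable_subtype_coe).measurableEmbedding (hBinj n).injective
    exact ⟨by rw [hι.comap_apply]; exact measure_lt_top _ _⟩
  -- The second projection is treated relative to `μ` transported along the graph `B n`, so that its
  -- exceptional null set pulls back to a null set in the first coordinate.
  have key := fun n => exists_isCountablyInjOn_ae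
    ((μ.comap fun b : B n => b.1.1.1).map fun b : B n => b.1.1.2) hq hqc
  choose S' hS' hae using key
  choose B' hB' hB'inj hS'B' using hS'
  have hemb : MeasurableEmbedding (Subtype.val : Γ → X × X) := MeasurableEmbedding.subtype_coe hΓ
  refine ⟨fun k => Subtype.val '' (B k.unpair.1 ∩ B' k.unpair.1 k.unpair.2), fun k => ?_,
    fun k => ?_, fun k => ?_, fun k => ?_, ?_⟩
  · exact hemb.measurableSet_image.2 ((hB _).inter (hB' _ _))
  · rintro _ ⟨e, -, rfl⟩
    exact e.2
  · rintro _ ⟨e, he, rfl⟩ _ ⟨e', he', rfl⟩ h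
    rw [hBinj _ he.1 he'.1 h]
  · rintro _ ⟨e, he, rfl⟩ _ ⟨e', he', rfl⟩ h
    rw [hB'inj _ _ he.2 he'.2 h]
  · have hae' := ae_all_iff.2 fun n => ae_of_ae_map_comap μ hp hq (hB n) (hBinj n) (hae n)
    filter_upwards [hS, hae'] with x hx hx' y hxy
    obtain ⟨n, hn⟩ := Set.mem_iUnion.1 (hx (show (⟨(x, y), hxy⟩ : Γ) ∈ _ from rfl))
    have h' := hx' n _ hn rfl (show (⟨(x, y), hxy⟩ : Γ) ∈ _ from rfl)
    rw [hS'B' n] at h'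
    obtain ⟨m, hm⟩ := Set.mem_iUnion.1 h'
    exact ⟨Nat.pair n m, ⟨(x, y), hxy⟩, by rw [Nat.unpair_pair]; exact ⟨hn, hm⟩, rfl⟩

/-- Including the complements of a separating sequence allows one to prescribe which of the two
points lies in the set. -/
theorem exists_seq_measurableSet_mem_notMem (X : Type*) [MeasurableSpace X]
    [StandardBorelSpace X] : ∃ W : ℕ → Set X, (∀ n, MeasurableSet (W n)) ∧
      ∀ x y, x ≠ y → ∃ n, x ∈ W n ∧ y ∉ W n := by
  obtain ⟨V, hVm, hVs⟩ := exists_seq_separating X MeasurableSet.empty (Set.univ : Set X)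
  obtain ⟨e, he⟩ := exists_surjective_nat (ℕ × Bool)
  refine ⟨fun k => bif (e k).2 then V (e k).1 else (V (e k).1)ᶜ, fun k => ?_, fun x y hne => ?_⟩
  · dsimp only
    rcases e k with ⟨m, _ | _⟩
    exacts [(hVm m).compl, hVm m]
  have : ∃ m, ¬ (x ∈ V m ↔ y ∈ V m) := by
    by_contra! h
    exact hne (hVs x (Set.mem_univ x) y (Set.mem_univ y) h)
  obtain ⟨m, hm⟩ := this
  by_cases hxm : x ∈ V m
  · obtain ⟨k, hk⟩ := he (m, true)
    refine ⟨k, ?_⟩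
    simp only [hk, cond_true]
    tauto
  · obtain ⟨k, hk⟩ := he (m, false)
    refine ⟨k, ?_⟩
    simp only [hk, cond_false, Set.mem_compl_iff]
    tauto

/-- A function whose graph is Borel is Borel. -/
theorem measurable_of_measurableSet_graph {f : X → X}
    (h : MeasurableSet {p : X × X | f p.1 = p.2}) :
    Measurable f := by
  intro V hV
  have : f ⁻¹' V = Prod.fst '' ({p : X × X | f p.1 = p.2} ∩ Prod.snd ⁻¹' V) := by
    ext x
    constructor
    · intro hx
      exact ⟨(x, f x), ⟨rfl, hx⟩, rfl⟩
    · rintro ⟨⟨a, b⟩, ⟨(hab : f a = b), hb⟩, rfl⟩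
      change f a ∈ V
      rwa [hab]
  rw [this]
  refine MeasurableSet.image_of_measurable_injOn (h.inter (measurable_snd hV)) measurable_fst ?_
  rintro ⟨a, b⟩ ⟨hab, -⟩ ⟨a', b'⟩ ⟨hab', -⟩ (rfl : a = a')
  rw [Prod.mk.injEq]
  exact ⟨rfl, hab.symm.trans hab'⟩

end GraphCover

/-! ### The full group as a group of Borel automorphisms -/

section Automorphisms

variable {X : Type*} [MeasurableSpace X] {μ : Measure X}

/-- The subgroup of Borel automorphisms `f` of `X` with `(x, f x) ∈ R` for all `x`. -/
def borelAutSubgroup (R : MPEquivRel μ) : Subgroup (Equiv.Perm X) where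
  carrier := {f | Measurable f ∧ Measurable f.symm ∧ ∀ x, R.r x (f x)}
  one_mem' := ⟨measurable_id, measurable_id, fun x => R.iseqv.refl x⟩
  mul_mem' := fun {f g} hf hg => ⟨hf.1.comp hg.1, hg.2.1.comp hf.2.1, fun x =>
    R.iseqv.trans (hg.2.2 x) (hf.2.2 (g x))⟩
  inv_mem' := fun {f} hf => ⟨hf.2.1, hf.1, fun x => R.iseqv.symm (by
    have := hf.2.2 (f.symm x)
    rwa [Equiv.apply_symm_apply] at this)⟩

/-- The group of Borel automorphisms `f` of `X` with `(x, f x) ∈ R` for all `x`. -/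
def BorelAut (R : MPEquivRel μ) : Type _ := borelAutSubgroup R

namespace BorelAut

variable {R : MPEquivRel μ}

instance : Group (BorelAut R) := inferInstanceAs (Group (borelAutSubgroup R))

instance : CoeFun (BorelAut R) fun _ => X → X := ⟨fun g => g.1⟩

theorem mul_apply (g h : BorelAut R) (x : X) : (g * h) x = g (h x) := rfl

theorem inv_apply_self (g : BorelAut R) (x : X) : g⁻¹ (g x) = x := g.1.symm_apply_apply x

theorem apply_inv_self (g : BorelAut R) (x : X) : g (g⁻¹ x) = x := g.1.apply_symm_apply x

theorem injective (g : BorelAut R) : Function.Injective g := g.1.injective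

theorem measurable (g : BorelAut R) : Measurable g := g.2.1

theorem rel (g : BorelAut R) (x : X) : R.r x (g x) := g.2.2.2 x

theorem measurableSet_image (g : BorelAut R) {A : Set X} (hA : MeasurableSet A) :
    MeasurableSet (g '' A) := by
  rw [g.1.image_eq_preimage_symm]
  exact g.2.2.1 hA

theorem memBorelFullSemigroup (g : BorelAut R) : MemBorelFullSemigroup R.r g.1.toPEquiv := by
  refine ⟨⟨fun B hB => ?_, fun B hB => ?_⟩, fun x y h => ?_⟩
  · convert g.2.1 hB using 1
    ext x
    simp [Equiv.toPEquiv_apply]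
  · convert g.measurableSet_image hB using 1
    ext x
    exact exists_congr fun y => and_congr_right fun _ => by simp [Equiv.toPEquiv_apply]
  · have : g x = y := by simpa [Equiv.toPEquiv_apply] using h
    exact this ▸ g.rel x

theorem measure_image (g : BorelAut R) {A : Set X} (hA : MeasurableSet A) : μ (g '' A) = μ A := by
  have := R.measure_image _ g.memBorelFullSemigroup A hA
    (fun x _ => by simp [Equiv.toPEquiv_apply])
  rw [← this]
  congr 1
  ext x
  exact exists_congr fun y => and_congr_right fun _ => by simp [Equiv.toPEquiv_apply]

theorem measure_preimage (g : BorelAut R) {A : Set X} (hA : MeasurableSet A) :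
    μ (g ⁻¹' A) = μ A := by
  have : g ⁻¹' A = (g⁻¹ : BorelAut R) '' A := (g⁻¹.1.image_eq_preimage_symm A).symm
  rw [this, measure_image _ hA]

theorem measurePreserving (g : BorelAut R) : MeasurePreserving g μ μ :=
  ⟨g.measurable, Measure.ext fun A hA => by
    rw [Measure.map_apply g.measurable hA, g.measure_preimage hA]⟩

theorem measurableSet_ne [StandardBorelSpace X] (g h : BorelAut R) :
    MeasurableSet {x | g x ≠ h x} :=
  (measurableSet_eq_fun g.measurable h.measurable).compl

/-- An involution of `X` inside `R` with Borel graph belongs to the full group. -/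
theorem exists_of_involutive [StandardBorelSpace X] {f : X → X} (hf : Function.Involutive f)
    (hR : ∀ x, R.r x (f x)) (hm : MeasurableSet {p : X × X | f p.1 = p.2}) :
    ∃ g : BorelAut R, ∀ x, g x = f x :=
  ⟨⟨hf.toPerm, measurable_of_measurableSet_graph hm, measurable_of_measurableSet_graph hm, hR⟩,
    fun _ => rfl⟩

/-- A partial injection inside `R` with Borel graph and disjoint domain and range extends to an
involution in the full group. -/
theorem exists_of_graph [StandardBorelSpace X] {B : Set (X × X)} (hB : MeasurableSet B)
    (hR : ∀ p ∈ B, R.r p.1 p.2) (h1 : Set.InjOn Prod.fst B) (h2 : Set.InjOn Prod.snd B)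
    (hd : Disjoint (Prod.fst '' B) (Prod.snd '' B)) :
    ∃ g : BorelAut R, (∀ x, g (g x) = x) ∧ ∀ x y, (x, y) ∈ B → g x = y := by
  classical
  have hdis : ∀ x y z, (x, y) ∈ B → (z, x) ∈ B → False := fun x y z h h' =>
    Set.disjoint_left.1 hd ⟨_, h, rfl⟩ ⟨_, h', rfl⟩
  have hf1 : ∀ {x y z}, (x, y) ∈ B → (x, z) ∈ B → y = z := fun h h' =>
    congrArg Prod.snd (h1 h h' rfl)
  have hf2 : ∀ {x y z}, (x, z) ∈ B → (y, z) ∈ B → x = y := fun h h' =>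
    congrArg Prod.fst (h2 h h' rfl)
  have hex : ∀ x, ∃ y, (x, y) ∈ B ∨ (y, x) ∈ B ∨
      (y = x ∧ x ∉ Prod.fst '' B ∧ x ∉ Prod.snd '' B) := fun x => by
    by_cases h : x ∈ Prod.fst '' B
    · obtain ⟨⟨a, b⟩, h, rfl⟩ := h
      exact ⟨b, Or.inl h⟩
    by_cases h' : x ∈ Prod.snd '' B
    · obtain ⟨⟨a, b⟩, hab, rfl⟩ := h'
      exact ⟨a, Or.inr (Or.inl hab)⟩
    exact ⟨x, Or.inr (Or.inr ⟨rfl, h, h'⟩)⟩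
  choose f hf using hex
  have hgraph : ∀ x y, f x = y ↔ ((x, y) ∈ B ∨ (y, x) ∈ B ∨
      (y = x ∧ x ∉ Prod.fst '' B ∧ x ∉ Prod.snd '' B)) := fun x y => by
    refine ⟨fun h => h ▸ hf x, fun h => ?_⟩
    rcases hf x with h' | h' | ⟨h', h3, h4⟩ <;> rcases h with h | h | ⟨h, h5, h6⟩
    · exact hf1 h' h
    · exact (hdis _ _ _ h' h).elim
    · exact (h5 ⟨_, h', rfl⟩).elim
    · exact (hdis _ _ _ h h').elim
    · exact hf2 h' h
    · exact (h6 ⟨_, h', rfl⟩).elim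
    · exact (h3 ⟨_, h, rfl⟩).elim
    · exact (h4 ⟨_, h, rfl⟩).elim
    · rw [h', h]
  have hinv : Function.Involutive f := fun x => by
    rw [hgraph]
    rcases hf x with h | h | ⟨h, h3, h4⟩
    · right; left; exact h
    · left; exact h
    · rw [h]
      exact Or.inr (Or.inr ⟨rfl, h3, h4⟩)
  have hrel : ∀ x, R.r x (f x) := fun x => by
    rcases hf x with h | h | ⟨h, -⟩
    · exact hR _ h
    · exact R.iseqv.symm (hR _ h)
    · rw [h]
  obtain ⟨g, hg⟩ := exists_of_involutive hinv hrel (by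
    simp only [hgraph]
    have hm1 : MeasurableSet (Prod.fst '' B) := hB.image_of_measurable_injOn measurable_fst h1
    have hm2 : MeasurableSet (Prod.snd '' B) := hB.image_of_measurable_injOn measurable_snd h2
    refine hB.union ((measurable_swap hB).union ?_)
    exact (measurableSet_eq_fun measurable_snd measurable_fst).inter
      ((measurable_fst hm1.compl).inter (measurable_fst hm2.compl)))
  refine ⟨g, fun x => ?_, fun x y h => ?_⟩
  · rw [hg, hg, hinv]
  · rw [hg, hgraph]
    exact Or.inl h

/-- Countably many involutions in the full group generate `R` almost everywhere. -/
theorem exists_seq_involutive [StandardBorelSpace X] [IsFiniteMeasure μ] (R : MPEquivRel μ) :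
    ∃ g : ℕ → BorelAut R, (∀ n x, g n (g n x) = x) ∧
      ∀ᵐ x ∂μ, ∀ y, R.r x y → x ≠ y → ∃ n, g n x = y := by
  obtain ⟨B, hB, hBR, hB1, hB2, hae⟩ := exists_cover_injOn_fst_snd μ R.measurableSet_graph
    R.countable_class fun y => (R.countable_class y).mono fun x hx => R.iseqv.symm hx
  obtain ⟨W, hWm, hW⟩ := exists_seq_measurableSet_mem_notMem X
  -- Cutting the graph down to `W m × (W m)ᶜ` makes its domain and range disjoint, so that it
  -- extends to an involution.
  have key : ∀ n m, ∃ g : BorelAut R, (∀ x, g (g x) = x) ∧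
      ∀ x y, (x, y) ∈ B n ∩ W m ×ˢ (W m)ᶜ → g x = y := fun n m =>
    exists_of_graph ((hB n).inter ((hWm m).prod (hWm m).compl)) (fun p hp => hBR n hp.1)
      ((hB1 n).mono Set.inter_subset_left) ((hB2 n).mono Set.inter_subset_left) (by
        rw [Set.disjoint_left]
        rintro x ⟨p, hp, rfl⟩ ⟨q, hq, hqp⟩
        exact hq.2.2 (hqp ▸ hp.2.1))
  choose g hg hgB using key
  refine ⟨fun k => g k.unpair.1 k.unpair.2, fun k => hg _ _, ?_⟩
  filter_upwards [hae] with x hx y hxy hne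
  obtain ⟨n, hn⟩ := hx y hxy
  obtain ⟨m, hm⟩ := hW x y hne
  refine ⟨Nat.pair n m, ?_⟩
  rw [Nat.unpair_pair]
  exact hgB n m x y ⟨hn, hm⟩

end BorelAut

end Automorphisms

/-! ### Supports in an aperiodic relation -/

section Support

variable {X : Type*} [MeasurableSpace X] [StandardBorelSpace X] {μ : Measure X} [IsFiniteMeasure μ]
  {R : MPEquivRel μ}

/-- In an aperiodic relation, a Borel set meeting each class in at most one point is null. -/
theorem IsAperiodic.measure_transversal_eq_zero (hR : IsAperiodic R) {C : Set X}
    (hC : MeasurableSet C) (hinj : ∀ x ∈ C, ∀ y ∈ C, R.r x y → x = y) : μ C = 0 := by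
  obtain ⟨g, -, hg⟩ := BorelAut.exists_seq_involutive R
  -- On `D n` the value `g n x` is new. As `C` meets each class at most once, the images `g n '' D
  -- n` are disjoint, so `∑ μ (D n)` is finite. By Borel-Cantelli almost every `x` lies in finitely
  -- many `D n`, and for `x ∈ C` this would make its class finite.
  set D : ℕ → Set X := fun n => {x | x ∈ C ∧ ∀ m < n, g m x ≠ g n x} with hD
  have hDm : ∀ n, MeasurableSet (D n) := fun n => by
    have : D n = C ∩ ⋂ m, ⋂ (_ : m < n), {x | g m x ≠ g n x} := by
      ext x; simp [hD]
    rw [this]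
    exact hC.inter (MeasurableSet.iInter fun m => MeasurableSet.iInter fun _ =>
      BorelAut.measurableSet_ne _ _)
  have hdisj : Pairwise (Function.onFun Disjoint fun n => g n '' D n) := by
    have aux : ∀ m n, m < n → Disjoint (g m '' D m) (g n '' D n) := fun m n hmn => by
      rw [Set.disjoint_left]
      rintro _ ⟨x, hx, rfl⟩ ⟨y, hy, hxy⟩
      have : x = y := hinj x hx.1 y hy.1 (R.iseqv.trans ((g m).rel x)
        (R.iseqv.symm (hxy ▸ (g n).rel y)))
      subst this
      exact hy.2 m hmn hxy.symm
    intro m n hmn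
    rcases lt_or_gt_of_ne hmn with h | h
    · exact aux m n h
    · exact (aux n m h).symm
  have hsum : ∑' n, μ (D n) ≠ ⊤ := by
    have : ∑' n, μ (D n) = μ (⋃ n, g n '' D n) := by
      rw [measure_iUnion hdisj fun n => (g n).measurableSet_image (hDm n)]
      exact tsum_congr fun n => ((g n).measure_image (hDm n)).symm
    rw [this]
    exact measure_ne_top _ _
  rw [measure_eq_zero_iff_ae_notMem]
  filter_upwards [hR, hg, ae_finite_setOfPred_mem hsum] with x hx hgx hfin hxC
  refine hx ?_
  refine ((hfin.image fun n => g n x).insert x).subset fun y hy => ?_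
  rcases eq_or_ne x y with rfl | hne
  · exact Set.mem_insert _ _
  refine Or.inr ?_
  classical
  have hex := hgx y hy hne
  refine ⟨Nat.find hex, ⟨hxC, fun m hm h => Nat.find_min hex hm ?_⟩, Nat.find_spec hex⟩
  rw [h, Nat.find_spec hex]

/-- In an aperiodic relation every Borel set is, up to a null set, the support of an involution. -/
theorem IsAperiodic.exists_support (hR : IsAperiodic R) {A : Set X} (hA : MeasurableSet A) :
    ∃ g : BorelAut R, ∀ᵐ x ∂μ, g x ≠ x ↔ x ∈ A := by
  classical
  obtain ⟨ψ, hψ, hae⟩ := BorelAut.exists_seq_involutive R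
  -- Greedy pairing: stage `n` removes from the remaining set all points that `ψ n` pairs within it,
  -- and `f` acts on them as `ψ n`.
  set D : ℕ → Set X → Set X := fun n S => {x | x ∈ S ∧ ψ n x ∈ S ∧ ψ n x ≠ x} with hD
  set S : ℕ → Set X := fun n => Nat.rec A (fun n S => S \ D n S) n with hS
  have hS1 : ∀ n, S (n + 1) = S n \ D n (S n) := fun n => rfl
  have hDm : ∀ n T, MeasurableSet T → MeasurableSet (D n T) := fun n T hT =>
    hT.inter (((ψ n).measurable hT).inter (BorelAut.measurableSet_ne (ψ n) 1))
  have hSm : ∀ n, MeasurableSet (S n) := fun n => by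
    induction n with
    | zero => exact hA
    | succ n ih => exact ih.diff (hDm n _ ih)
  have hanti : Antitone S := antitone_nat_of_succ_le fun n => Set.sdiff_subset
  have hdis : ∀ m n, m < n → ∀ x, x ∈ D m (S m) → x ∉ D n (S n) := fun m n hmn x hx hx' =>
    (hanti (Nat.succ_le_of_lt hmn) hx'.1).2 hx
  have huniq : ∀ m n x, x ∈ D m (S m) → x ∈ D n (S n) → m = n := fun m n x hm hn => by
    rcases lt_trichotomy m n with h | h | h
    · exact (hdis m n h x hm hn).elim
    · exact h
    · exact (hdis n m h x hn hm).elim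
  have hDψ : ∀ n x, x ∈ D n (S n) → ψ n x ∈ D n (S n) := fun n x hx =>
    ⟨hx.2.1, by rw [hψ]; exact hx.1, by rw [hψ]; exact hx.2.2.symm⟩
  have hex : ∀ x, ∃ y, (∃ n, x ∈ D n (S n) ∧ ψ n x = y) ∨ ((∀ n, x ∉ D n (S n)) ∧ x = y) :=
    fun x => by
      by_cases h : ∃ n, x ∈ D n (S n)
      · obtain ⟨n, hn⟩ := h
        exact ⟨_, Or.inl ⟨n, hn, rfl⟩⟩
      · exact ⟨x, Or.inr ⟨not_exists.1 h, rfl⟩⟩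
  choose f hf using hex
  have hgraph : ∀ x y, f x = y ↔
      ((∃ n, x ∈ D n (S n) ∧ ψ n x = y) ∨ ((∀ n, x ∉ D n (S n)) ∧ x = y)) := fun x y => by
    refine ⟨fun h => h ▸ hf x, fun h => ?_⟩
    rcases hf x with ⟨n, hn, h1⟩ | ⟨hn, h1⟩ <;> rcases h with ⟨m, hm, h2⟩ | ⟨hm, h2⟩
    · obtain rfl := huniq _ _ _ hn hm
      rw [← h1, h2]
    · exact (hm n hn).elim
    · exact (hn m hm).elim
    · rw [← h1, h2]
  have hfD : ∀ n x, x ∈ D n (S n) → f x = ψ n x := fun n x hx =>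
    (hgraph _ _).2 (Or.inl ⟨n, hx, rfl⟩)
  have hinv : Function.Involutive f := fun x => by
    by_cases h : ∃ n, x ∈ D n (S n)
    · obtain ⟨n, hn⟩ := h
      rw [hfD n x hn, hfD n _ (hDψ n x hn), hψ]
    · have := (hgraph x x).2 (Or.inr ⟨not_exists.1 h, rfl⟩)
      rw [this, this]
  obtain ⟨g, hg⟩ := BorelAut.exists_of_involutive (R := R) hinv (fun x => by
    rcases hf x with ⟨n, -, h⟩ | ⟨-, h⟩
    · exact h ▸ (ψ n).rel x
    · rw [← h]) (by
    have : {p : X × X | f p.1 = p.2} =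
        (⋃ n, Prod.fst ⁻¹' D n (S n) ∩ {p | ψ n p.1 = p.2}) ∪
          (⋂ n, Prod.fst ⁻¹' (D n (S n))ᶜ) ∩ {p | p.1 = p.2} := by
      ext p
      simp [hgraph]
    rw [this]
    refine (MeasurableSet.iUnion fun n => (measurable_fst (hDm n _ (hSm n))).inter
      (measurableSet_eq_fun ((ψ n).measurable.comp measurable_fst) measurable_snd)).union
      ((MeasurableSet.iInter fun n => measurable_fst (hDm n _ (hSm n)).compl).inter
        (measurableSet_eq_fun measurable_fst measurable_snd)))
  set N := toMeasurable μ {x | ¬∀ y, R.r x y → x ≠ y → ∃ n, ψ n x = y} with hN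
  have hN0 : μ N = 0 := by rw [hN, measure_toMeasurable]; exact ae_iff.1 hae
  -- Two distinct related survivors `x` and `y = ψ n x` would have been paired at stage `n`, so the
  -- survivors outside `N` form a partial transversal.
  have hC0 : μ ((⋂ n, S n) \ N) = 0 := by
    refine hR.measure_transversal_eq_zero ((MeasurableSet.iInter hSm).diff
      (measurableSet_toMeasurable _ _)) fun x hx y hy hxy => ?_
    by_contra hne
    have hxN : ∀ y, R.r x y → x ≠ y → ∃ n, ψ n x = y := by
      by_contra h
      exact hx.2 (subset_toMeasurable _ _ h)
    obtain ⟨n, hn⟩ := hxN y hxy hne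
    have h1 := Set.mem_iInter.1 hx.1 (n + 1)
    rw [hS1] at h1
    refine h1.2 ⟨h1.1, ?_, ?_⟩ <;> rw [hn]
    · exact Set.mem_iInter.1 hy.1 n
    · exact fun h => hne h.symm
  refine ⟨g, ?_⟩
  filter_upwards [measure_eq_zero_iff_ae_notMem.1 hN0, measure_eq_zero_iff_ae_notMem.1 hC0]
    with x hxN hxC
  rw [hg]
  have key : (∃ n, x ∈ D n (S n)) ↔ x ∈ A := by
    constructor
    · rintro ⟨n, hn⟩
      exact hanti (Nat.zero_le n) hn.1
    · intro hx
      by_contra! h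
      refine hxC ⟨Set.mem_iInter.2 fun n => ?_, hxN⟩
      induction n with
      | zero => exact hx
      | succ n ih => exact ⟨ih, h n⟩
  rw [← key]
  constructor
  · intro h
    by_contra! h'
    exact h ((hgraph x x).2 (Or.inr ⟨h', rfl⟩))
  · rintro ⟨n, hn⟩
    rw [hfD n x hn]
    exact hn.2.2

end Support

/-! ### The metric on Borel automorphisms and the quotient map to the full group -/

section Metric

variable {X : Type*} [MeasurableSpace X] {μ : Measure X} {R : MPEquivRel μ}

namespace BorelAut

/-- The inclusion of the full group in the full semigroup, on the level of Borel maps. -/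
def toBorelFullSemigroup : BorelAut R →* BorelFullSemigroup R where
  toFun g := ⟨g.1.toPEquiv, g.memBorelFullSemigroup⟩
  map_one' := rfl
  map_mul' _ _ := rfl

theorem toBorelFullSemigroup_apply (g : BorelAut R) (x : X) :
    (toBorelFullSemigroup g).1 x = some (g x) := rfl

theorem exists_toBorelFullSemigroup_eq {φ : BorelFullSemigroup R}
    (hφ : φ ∈ BorelFullSemigroup.fullGroup R) : ∃ g : BorelAut R, toBorelFullSemigroup g = φ := by
  have h1 : ∀ x, (φ.1 x).isSome := fun x => by
    have : x ∈ φ.dom := by rw [hφ.1]; trivial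
    exact this
  have h2 : ∀ x, (φ.1.symm x).isSome := fun x => by
    have : x ∈ φ.ran := by rw [hφ.2]; trivial
    exact this
  have h3 : ∀ x y, (φ.1 x).get (h1 x) = y ↔ φ.1 x = some y := fun x y => by
    exact ⟨fun h => h ▸ (Option.some_get _).symm, fun h => Option.get_of_eq_some _ h⟩
  have h4 : ∀ x y, (φ.1.symm x).get (h2 x) = y ↔ φ.1 y = some x := fun x y => by
    rw [← PEquiv.eq_some_iff]
    exact ⟨fun h => h ▸ (Option.some_get _).symm, fun h => Option.get_of_eq_some _ h⟩
  refine ⟨⟨⟨fun x => (φ.1 x).get (h1 x), fun y => (φ.1.symm y).get (h2 y), fun x => ?_,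
    fun x => ?_⟩, ?_, ?_, fun x => ?_⟩, ?_⟩
  · simp [h4]
  · rw [h3, ← PEquiv.eq_some_iff]
    simp
  · intro B hB
    convert φ.2.1.1 B hB using 1
    ext x
    simp [← h3]
  · intro B hB
    convert φ.2.1.2 B hB using 1
    ext x
    simp [← h4]
  · exact φ.2.2 _ _ ((h3 _ _).1 rfl)
  · refine Subtype.ext (PEquiv.ext fun x => ?_)
    exact Option.some_get (h1 x)

variable [IsProbabilityMeasure μ]

instance : PseudoMetricSpace (BorelAut R) :=
  PseudoMetricSpace.induced toBorelFullSemigroup inferInstance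

theorem dist_toBorelFullSemigroup (g h : BorelAut R) :
    dist (toBorelFullSemigroup g) (toBorelFullSemigroup h) = dist g h := rfl

theorem dist_eq (g h : BorelAut R) : dist g h = μ.real {x | g x ≠ h x} := by
  rw [← dist_toBorelFullSemigroup, BorelFullSemigroup.dist_def]
  simp only [toBorelFullSemigroup_apply, ne_eq, Option.some.injEq]

theorem dist_mul_le (g g' h h' : BorelAut R) : dist (g * h) (g' * h') ≤ dist g g' + dist h h' := by
  simp only [← dist_toBorelFullSemigroup, map_mul]
  exact BorelFullSemigroup.dist_mul_le _ _ _ _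

/-- The map from Borel automorphisms inside `R` to the full group `[R]`. -/
def toFullGroup : BorelAut R →* FullGroup R :=
  (SeparationQuotient.mkMonoidHom.comp toBorelFullSemigroup).codRestrict (FullGroup R) fun g =>
    ⟨toBorelFullSemigroup g, ⟨by ext x; simp [BorelFullSemigroup.dom, toBorelFullSemigroup_apply],
      by
        ext x
        simp only [BorelFullSemigroup.ran, Set.mem_ofPred_eq, Set.mem_univ, iff_true]
        rfl⟩, rfl⟩

theorem coe_toFullGroup (g : BorelAut R) :
    (toFullGroup g : FullSemigroup R) = SeparationQuotient.mk (toBorelFullSemigroup g) := rfl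

theorem dist_toFullGroup (g h : BorelAut R) : dist (toFullGroup g) (toFullGroup h) = dist g h := by
  rw [Subtype.dist_eq, coe_toFullGroup, coe_toFullGroup, SeparationQuotient.dist_mk,
    dist_toBorelFullSemigroup]

theorem toFullGroup_surjective : Function.Surjective (toFullGroup (R := R)) := by
  rintro ⟨_, φ, hφ, rfl⟩
  obtain ⟨g, rfl⟩ := exists_toBorelFullSemigroup_eq hφ
  exact ⟨g, rfl⟩

end BorelAut

end Metric

/-! ### Separability of the full group -/

section Separable

theorem tendsto_measureReal_setOf_forall_lt_notMem {X : Type*} [MeasurableSpace X]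
    {μ : Measure X} [IsFiniteMeasure μ] {T : Set X}
    (hT : MeasurableSet T) {A : ℕ → Set X} (hA : ∀ n, MeasurableSet (A n))
    (h : ∀ᵐ x ∂μ, x ∈ T → ∃ n, x ∈ A n) :
    Tendsto (fun M => μ.real {x | x ∈ T ∧ ∀ n < M, x ∉ A n}) atTop (𝓝 0) := by
  have hm : ∀ M, MeasurableSet {x | x ∈ T ∧ ∀ n < M, x ∉ A n} := fun M => by
    have : {x | x ∈ T ∧ ∀ n < M, x ∉ A n} = T ∩ ⋂ n, ⋂ (_ : n < M), (A n)ᶜ := by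
      ext x; simp
    rw [this]
    exact hT.inter (MeasurableSet.iInter fun n => MeasurableSet.iInter fun _ => (hA n).compl)
  have h0 : μ (⋂ M, {x | x ∈ T ∧ ∀ n < M, x ∉ A n}) = 0 := by
    rw [measure_eq_zero_iff_ae_notMem]
    filter_upwards [h] with x hx hx'
    rw [Set.mem_iInter] at hx'
    obtain ⟨n, hn⟩ := hx (hx' 0).1
    exact (hx' (n + 1)).2 n n.lt_succ_self hn
  have := tendsto_measure_iInter_atTop (μ := μ) (fun M => (hm M).nullMeasurableSet)
    (fun M M' hMM' x hx => ⟨hx.1, fun n hn => hx.2 n (hn.trans_le hMM')⟩) ⟨0, measure_ne_top _ _⟩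
  rw [h0] at this
  exact (ENNReal.tendsto_toReal ENNReal.zero_ne_top).comp this

variable {X : Type*} [MeasurableSpace X] [StandardBorelSpace X] {μ : Measure X}

instance [IsFiniteMeasure μ] : TopologicalSpace.SeparableSpace (MeasuredSets μ) := by
  obtain ⟨𝒜, hc, h𝒜⟩ := exists_countable_measureDense μ
  refine ⟨{s | (s : Set X) ∈ 𝒜}, hc.preimage SetLike.coe_injective, fun s => ?_⟩
  rw [Metric.mem_closure_iff]
  intro ε hε
  obtain ⟨t, ht, hst⟩ := h𝒜.approx s.1 s.2 (measure_ne_top _ _) ε hε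
  let t' : MeasuredSets μ := ⟨t, h𝒜.measurable t ht⟩
  refine ⟨t', ht, ?_⟩
  rw [MeasuredSets.dist_def]
  exact ENNReal.toReal_lt_of_lt_ofReal hst

/-- The full group of a countable Borel equivalence relation is separable. -/
theorem BorelAut.exists_denseSeq [IsProbabilityMeasure μ] (R : MPEquivRel μ) :
    ∃ u : ℕ → BorelAut R, DenseRange u := by
  obtain ⟨ψ, -, hψ⟩ := BorelAut.exists_seq_involutive R
  -- `g` is encoded by the sets where it agrees with the identity (index `0`) or with `ψ (n - 1)`
  -- (index `n ≥ 1`). The code lives in a second countable space, so the topology induced by `D` has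
  -- a dense sequence.
  set D : BorelAut R → ℕ → MeasuredSets μ := fun g n =>
    ⟨{x | g x = (Nat.casesOn n 1 ψ : BorelAut R) x}, measurableSet_eq_fun g.measurable
      (BorelAut.measurable _)⟩ with hD
  have hcov : ∀ g : BorelAut R, ∀ᵐ x ∂μ, ∃ n, x ∈ (D g n : Set X) := fun g => by
    filter_upwards [hψ] with x hx
    rcases eq_or_ne x (g x) with h | h
    · exact ⟨0, h.symm⟩
    · obtain ⟨n, hn⟩ := hx _ (g.rel x) h
      exact ⟨n + 1, hn.symm⟩
  let t : TopologicalSpace (BorelAut R) := TopologicalSpace.induced D inferInstance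
  have ht : @SecondCountableTopology (BorelAut R) t := by
    have : SecondCountableTopology (MeasuredSets μ) :=
      UniformSpace.secondCountable_of_separable _
    exact TopologicalSpace.secondCountableTopology_induced _ _ D
  obtain ⟨u, hu⟩ := @TopologicalSpace.exists_dense_seq (BorelAut R) t _ ⟨1⟩
  refine ⟨u, fun g => Metric.mem_closure_range_iff.2 fun ε hε => ?_⟩
  -- Off a set of measure below `ε / 2`, `g` agrees with one of the first `M` maps. There `u k`
  -- agrees with `g` outside `M` symmetric differences of measure below `ε / (2 * (M + 1))`; the `+
  -- 1` covers `M = 0`.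
  obtain ⟨M, hM⟩ := ((tendsto_measureReal_setOf_forall_lt_notMem (μ := μ) MeasurableSet.univ
    (fun n => (D g n).2) ((hcov g).mono fun x hx _ => hx)).eventually
      (gt_mem_nhds (half_pos hε))).exists
  have hopen : @IsOpen (BorelAut R) t (D ⁻¹' ⋂ n ∈ Finset.range M,
      {d | dist (d n) (D g n) < ε / (2 * (M + 1))}) :=
    ⟨_, isOpen_biInter_finset fun n _ => isOpen_lt
      ((continuous_apply n).dist continuous_const) continuous_const, rfl⟩
  obtain ⟨k, hk⟩ := hu.exists_mem_open hopen ⟨g, by simp; intros; positivity⟩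
  refine ⟨k, ?_⟩
  have hk : ∀ n ∈ Finset.range M, dist (D (u k) n) (D g n) < ε / (2 * (M + 1)) := by simpa using hk
  rw [BorelAut.dist_eq]
  calc μ.real {x | g x ≠ u k x}
      ≤ μ.real ({x | x ∈ Set.univ ∧ ∀ n < M, x ∉ (D g n : Set X)} ∪
          ⋃ n ∈ Finset.range M, symmDiff (D (u k) n : Set X) (D g n)) := by
        refine measureReal_mono fun x hx => ?_
        by_contra h
        simp only [Set.mem_union, Set.mem_iUnion, Finset.mem_range, Set.mem_ofPred_eq, not_or,
          not_and, not_exists, not_forall, not_not, Set.mem_symmDiff] at h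
        obtain ⟨h1, h⟩ := h
        obtain ⟨n, hn, hxn⟩ := h1 trivial
        have hxk := (h n hn).2 hxn
        exact hx (Eq.trans (show g x = _ from hxn) (show u k x = _ from hxk).symm)
    _ ≤ μ.real {x | x ∈ Set.univ ∧ ∀ n < M, x ∉ (D g n : Set X)} +
          ∑ n ∈ Finset.range M, μ.real (symmDiff (D (u k) n : Set X) (D g n)) :=
        (measureReal_union_le _ _).trans
          (by gcongr; exact measureReal_biUnion_finset_le _ _)
    _ ≤ μ.real {x | x ∈ Set.univ ∧ ∀ n < M, x ∉ (D g n : Set X)} +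
          ∑ n ∈ Finset.range M, ε / (2 * (M + 1)) := by
        gcongr with n hn
        exact (hk n hn).le
    _ < ε / 2 + ε / 2 := by
        refine add_lt_add_of_lt_of_le hM ?_
        rw [Finset.sum_const, Finset.card_range, nsmul_eq_mul, ← div_div, mul_div_assoc',
          div_le_iff₀ (by positivity), mul_comm]
        gcongr
        linarith
    _ = ε := add_halves ε

end Separable

/-! ### Estimates for the normalized Hamming distance -/

section Hamming

variable {N : ℕ}

theorem normHamming_comm {β : Type} [DecidableEq β] (x y : Fin N → β) :
    normHamming x y = normHamming y x := by
  rw [normHamming, normHamming, hammingDist_comm]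

theorem normHamming_triangle {β : Type} [DecidableEq β] (x y z : Fin N → β) :
    normHamming x z ≤ normHamming x y + normHamming y z := by
  simp only [normHamming, ← add_div]
  gcongr
  exact_mod_cast hammingDist_triangle x y z

theorem normHamming_mono {β γ : Type} [DecidableEq β] [DecidableEq γ] {x y : Fin N → β}
    {x' y' : Fin N → γ} (h : ∀ i, x i ≠ y i → x' i ≠ y' i) :
    normHamming x y ≤ normHamming x' y' := by
  unfold normHamming hammingDist
  refine div_le_div_of_nonneg_right ?_ N.cast_nonneg
  exact_mod_cast Finset.card_le_card fun i hi => by simpa using h i (by simpa using hi)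

theorem normHamming_le_of_injOn {β γ : Type} [DecidableEq β] [DecidableEq γ] {x y : Fin N → β}
    {x' y' : Fin N → γ} (f : Fin N → Fin N) (hf : Set.InjOn f {i | x i ≠ y i})
    (h : ∀ i, x i ≠ y i → x' (f i) ≠ y' (f i)) : normHamming x y ≤ normHamming x' y' := by
  unfold normHamming hammingDist
  refine div_le_div_of_nonneg_right ?_ N.cast_nonneg
  norm_cast
  refine Finset.card_le_card_of_injOn f (fun i hi => ?_) (fun i hi j hj hij => ?_)
  · simpa using h i (by simpa using hi)
  · exact hf (by simpa using hi) (by simpa using hj) hij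

theorem normHamming_toPEquiv (σ τ : Equiv.Perm (Fin N)) :
    normHamming (σ.toPEquiv) (τ.toPEquiv) = normHamming σ τ := by
  refine le_antisymm ?_ ?_ <;>
  · refine normHamming_mono fun i h => ?_
    simpa [Equiv.toPEquiv_apply] using h

theorem normHamming_trans_left (f f' g : Fin N ≃. Fin N) :
    normHamming (f.trans g) (f'.trans g) ≤ normHamming f f' := by
  refine normHamming_mono fun i h h' => h ?_
  change (f i).bind g = (f' i).bind g
  rw [h']

theorem normHamming_trans_right (f g g' : Fin N ≃. Fin N) :
    normHamming (f.trans g) (f.trans g') ≤ normHamming g g' := by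
  have key : ∀ i, f.trans g i ≠ f.trans g' i → ∃ j, f i = some j ∧ g j ≠ g' j := fun i h => by
    change (f i).bind g ≠ (f i).bind g' at h
    cases hf : f i with
    | none => simp [hf] at h
    | some j => exact ⟨j, rfl, by simpa [hf] using h⟩
  -- The default value plays no role: where the two composites differ, `f i` is defined.
  refine normHamming_le_of_injOn (fun i => (f i).getD i) (fun i hi i' hi' h => ?_) fun i hi => ?_
  · obtain ⟨j, hj, -⟩ := key i hi
    obtain ⟨j', hj', -⟩ := key i' hi'
    simp only [hj, hj', Option.getD_some] at h
    subst h
    exact f.inj hj hj'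
  · obtain ⟨j, hj, hne⟩ := key i hi
    simpa only [hj, Option.getD_some] using hne

theorem normHamming_refl (hN : 0 < N) (f : Fin N ≃. Fin N) :
    normHamming f (PEquiv.refl (Fin N)) = 1 - finTrace f := by
  have hN' : (N : ℝ) ≠ 0 := by exact_mod_cast hN.ne'
  unfold normHamming finTrace hammingDist
  rw [Nat.card_eq_fintype_card, Fintype.card_subtype, eq_sub_iff_add_eq, ← add_div,
    div_eq_one_iff_eq hN']
  norm_cast
  have := Finset.card_filter_add_card_filter_not (s := (Finset.univ : Finset (Fin N)))
    (fun i => f i ≠ PEquiv.refl (Fin N) i)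
  simp only [Finset.card_univ, Fintype.card_fin, not_not] at this
  exact this

/-- In a finite set the complements of the domain and of the range have the same size. -/
theorem exists_perm_extends (f : Fin N ≃. Fin N) :
    ∃ σ : Equiv.Perm (Fin N), ∀ i j, f i = some j → σ i = j := by
  let e : {i // (f i).isSome} ≃ {j // (f.symm j).isSome} :=
    { toFun := fun i => ⟨(f i.1).get i.2, by
        have : f.symm ((f i.1).get i.2) = some i.1 := f.eq_some_iff.2 (Option.some_get _).symm
        simp [this]⟩
      invFun := fun j => ⟨(f.symm j.1).get j.2, by
        have : f ((f.symm j.1).get j.2) = some j.1 := f.eq_some_iff.1 (Option.some_get _).symm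
        simp [this]⟩
      left_inv := fun i => Subtype.ext <| Option.get_of_eq_some _ <|
        f.eq_some_iff.2 (Option.some_get _).symm
      right_inv := fun j => Subtype.ext <| Option.get_of_eq_some _ <|
        f.eq_some_iff.1 (Option.some_get _).symm }
  refine ⟨e.extendSubtype, fun i j h => ?_⟩
  rw [e.extendSubtype_apply_of_mem i (by simp [h])]
  exact Option.get_of_eq_some _ h

/-- Wherever `f` followed by `g` fixes a point, `f` is defined and `σ` agrees with it. With `g` an
approximate inverse of `f`, extending `f` to `σ` costs little. -/
theorem normHamming_extends_le {f : Fin N ≃. Fin N} {σ : Equiv.Perm (Fin N)}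
    (h : ∀ i j, f i = some j → σ i = j) (g : Fin N ≃. Fin N) :
    normHamming f σ.toPEquiv ≤ normHamming (f.trans g) (PEquiv.refl (Fin N)) := by
  refine normHamming_mono fun i hi h' => hi ?_
  obtain ⟨j, hj, -⟩ := (PEquiv.mem_trans f g i i).1 h'
  have hj : f i = some j := hj
  rw [hj, Equiv.toPEquiv_apply, h i j hj]

end Hamming

/-! ### From soficity to almost homomorphisms into symmetric groups -/

section Approximation

variable {X : Type*} [MeasurableSpace X] {μ : Measure X} [IsProbabilityMeasure μ]
  {R : MPEquivRel μ}

theorem FullSemigroup.trace_mk (φ : BorelFullSemigroup R)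
    (h : MeasurableSet {x | φ.1 x ≠ some x}) :
    FullSemigroup.trace (SeparationQuotient.mk φ) = 1 - dist φ 1 := by
  change μ.real φ.fix = _
  have : φ.fix = {x | φ.1 x ≠ some x}ᶜ := by
    ext x
    simp [BorelFullSemigroup.fix]
  rw [this, probReal_compl_eq_one_sub h]
  rfl

theorem BorelAut.trace_coe [StandardBorelSpace X] (g : BorelAut R) :
    FullSemigroup.trace (BorelAut.toFullGroup g : FullSemigroup R) = 1 - dist g 1 := by
  rw [BorelAut.coe_toFullGroup, FullSemigroup.trace_mk, ← BorelAut.dist_toBorelFullSemigroup,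
    map_one]
  simp only [BorelAut.toBorelFullSemigroup_apply, ne_eq, Option.some.injEq]
  exact BorelAut.measurableSet_ne g 1

theorem BorelAut.dist_inv_mul (g h : BorelAut R) : dist (g⁻¹ * h) 1 = dist g h := by
  refine le_antisymm ?_ ?_
  · have := BorelAut.dist_mul_le g⁻¹ g⁻¹ h g
    rwa [inv_mul_cancel, dist_self, zero_add, dist_comm h] at this
  · have := BorelAut.dist_mul_le g g (g⁻¹ * h) 1
    rwa [mul_inv_cancel_left, mul_one, dist_self, zero_add, dist_comm h] at this

/-- A sofic relation admits almost isometric almost homomorphisms from the full group to finite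
symmetric groups. -/
theorem IsSofic.exists_perm [StandardBorelSpace X] (hS : IsSofic R) (K : Finset (BorelAut R))
    {ε : ℝ} (hε : 0 < ε) :
    ∃ N : ℕ, 0 < N ∧ ∃ σ : BorelAut R → Equiv.Perm (Fin N),
      (∀ g ∈ K, ∀ h ∈ K, normHamming (σ (g * h)) (σ g * σ h : Equiv.Perm (Fin N)) < ε) ∧
      ∀ g ∈ K, ∀ h ∈ K, |dist g h - normHamming (σ g) (σ h)| < ε := by
  classical
  -- The quotients `g⁻¹ * h` are included because `d(g, h)` is read off from their trace; `K₂` also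
  -- contains inverses, which make the `ρ g` almost total.
  set K₁ : Finset (BorelAut R) := K ∪ Finset.image₂ (fun g h => g * h) K K ∪
    Finset.image₂ (fun g h => g⁻¹ * h) K K with hK₁
  set K₂ : Finset (BorelAut R) := K₁ ∪ K₁.image fun g => g⁻¹ with hK₂
  have hinv : ∀ g ∈ K₂, g⁻¹ ∈ K₂ := fun g hg => by
    rw [hK₂, Finset.mem_union] at hg ⊢
    rcases hg with hg | hg
    · exact Or.inr (Finset.mem_image_of_mem _ hg)
    · obtain ⟨g', hg', rfl⟩ := Finset.mem_image.1 hg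
      rw [inv_inv]
      exact Or.inl hg'
  have hK : ∀ g ∈ K, g ∈ K₂ := fun g hg => by simp [hK₂, hK₁, hg]
  have hmul : ∀ g ∈ K, ∀ h ∈ K, g * h ∈ K₂ := fun g hg h hh =>
    Finset.mem_union_left _ (Finset.mem_union_left _ (Finset.mem_union_right _
      (Finset.mem_image₂_of_mem hg hh)))
  have hdiv : ∀ g ∈ K, ∀ h ∈ K, g⁻¹ * h ∈ K₂ := fun g hg h hh =>
    Finset.mem_union_left _ (Finset.mem_union_right _ (Finset.mem_image₂_of_mem hg hh))
  obtain ⟨N, hN, π, hπ1, -, hπm, hπt⟩ := hS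
    (K₂.image fun g => (BorelAut.toFullGroup g : FullSemigroup R)) (ε / 12) (by positivity)
  set ρ : BorelAut R → (Fin N ≃. Fin N) := fun g => π (BorelAut.toFullGroup g) with hρ
  have hρ1 : ρ 1 = PEquiv.refl (Fin N) := by
    simp only [hρ, map_one]
    exact hπ1
  have hρm : ∀ g ∈ K₂, ∀ h ∈ K₂, normHamming (ρ (g * h)) ((ρ h).trans (ρ g)) < ε / 12 :=
    fun g hg h hh => by
      have := hπm _ (Finset.mem_image_of_mem _ hg) _ (Finset.mem_image_of_mem _ hh)
      simp only [hρ, map_mul]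
      exact this
  have hρt : ∀ g ∈ K₂, |dist g 1 - normHamming (ρ g) (PEquiv.refl (Fin N))| < ε / 12 :=
    fun g hg => by
      have := hπt _ (Finset.mem_image_of_mem _ hg)
      rw [BorelAut.trace_coe] at this
      rw [normHamming_refl hN, abs_sub_comm]
      convert this using 2
      ring
  choose σ hσ using fun g => exists_perm_extends (ρ g)
  have hσρ : ∀ g ∈ K₂, normHamming (ρ g) (σ g).toPEquiv < ε / 12 := fun g hg => by
    refine (normHamming_extends_le (hσ g) (ρ g⁻¹)).trans_lt ?_
    have := hρm g⁻¹ (hinv g hg) g hg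
    rwa [inv_mul_cancel, hρ1, normHamming_comm] at this
  -- One error of `ε / 12` from the multiplicativity of `ρ` and three from replacing `ρ` by `σ`.
  have hσm : ∀ g ∈ K₂, ∀ h ∈ K₂, g * h ∈ K₂ →
      normHamming (σ (g * h)) (σ g * σ h : Equiv.Perm (Fin N)) < 4 * (ε / 12) :=
    fun g hg h hh hgh => by
      rw [← normHamming_toPEquiv]
      have e : (σ g * σ h).toPEquiv = (σ h).toPEquiv.trans (σ g).toPEquiv := rfl
      rw [e]
      have h1 := normHamming_triangle (σ (g * h)).toPEquiv (ρ (g * h))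
        ((σ h).toPEquiv.trans (σ g).toPEquiv)
      have h2 := normHamming_triangle (ρ (g * h)) ((ρ h).trans (ρ g))
        ((σ h).toPEquiv.trans (σ g).toPEquiv)
      have h3 := normHamming_triangle ((ρ h).trans (ρ g)) ((ρ h).trans (σ g).toPEquiv)
        ((σ h).toPEquiv.trans (σ g).toPEquiv)
      have h4 := normHamming_trans_right (ρ h) (ρ g) (σ g).toPEquiv
      have h5 := normHamming_trans_left (ρ h) (σ h).toPEquiv (σ g).toPEquiv
      have h6 := hσρ _ hgh
      rw [normHamming_comm] at h6
      have h7 := hσρ _ hg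
      have h8 := hσρ _ hh
      have h9 := hρm _ hg _ hh
      linarith
  refine ⟨N, hN, σ, fun g hg h hh => (hσm g (hK g hg) h (hK h hh) (hmul g hg h hh)).trans
    (by linarith), fun g hg h hh => ?_⟩
  have hgi := hinv g (hK g hg)
  have h1K : (1 : BorelAut R) ∈ K₂ := by
    have := hdiv g hg g hg
    rwa [inv_mul_cancel] at this
  -- By left invariance it suffices to compare `σ g⁻¹ * σ g`, close to `σ 1` and thus to the
  -- identity, with `σ g⁻¹ * σ h`, close to `σ (g⁻¹ * h)` and thus to `ρ (g⁻¹ * h)`. The errors are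
  -- `4 + 1 + 4 + 1` units of `ε / 12`, and one more comes from the trace.
  have e : normHamming (σ g) (σ h) =
      normHamming (σ g⁻¹ * σ g : Equiv.Perm (Fin N)) (σ g⁻¹ * σ h : Equiv.Perm (Fin N)) := by
    unfold normHamming
    congr 2
    exact (hammingDist_comp (fun _ => σ g⁻¹) fun _ => (σ g⁻¹).injective).symm
  have h1 := hσm _ hgi g (hK g hg) (by rwa [inv_mul_cancel])
  have h2 := hσm _ hgi h (hK h hh) (hdiv g hg h hh)
  rw [inv_mul_cancel] at h1
  have h3 := hσρ 1 h1K
  rw [hρ1] at h3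
  have h4 := hσρ _ (hdiv g hg h hh)
  have h5 := hρt _ (hdiv g hg h hh)
  rw [BorelAut.dist_inv_mul] at h5
  rw [e, ← normHamming_toPEquiv]
  rw [← normHamming_toPEquiv] at h1 h2
  clear_value ρ
  generalize ((σ (g⁻¹ * h)).toPEquiv : Fin N → Option (Fin N)) = a at *
  generalize ((σ g⁻¹ * σ g).toPEquiv : Fin N → Option (Fin N)) = b at *
  generalize ((σ g⁻¹ * σ h).toPEquiv : Fin N → Option (Fin N)) = c at *
  generalize ((σ 1).toPEquiv : Fin N → Option (Fin N)) = d at *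
  generalize (ρ (g⁻¹ * h) : Fin N → Option (Fin N)) = r at *
  generalize (PEquiv.refl (Fin N) : Fin N → Option (Fin N)) = i at *
  have t1 := normHamming_triangle b d c
  have t2 := normHamming_triangle d i c
  have t3 := normHamming_triangle i r c
  have t4 := normHamming_triangle r a c
  have s1 := normHamming_triangle r a i
  have s2 := normHamming_triangle a c i
  have s3 := normHamming_triangle c b i
  have s4 := normHamming_triangle b d i
  have c1 := normHamming_comm d b
  have c2 := normHamming_comm d i
  have c3 := normHamming_comm i r
  have c4 := normHamming_comm c b
  have c5 := normHamming_comm c a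
  rw [abs_lt] at h5 ⊢
  constructor <;> linarith

end Approximation

/-! ### From almost homomorphisms to an isometric embedding -/

section Embedding

variable {X : Type*} [MeasurableSpace X] {μ : Measure X} [IsProbabilityMeasure μ]
  {R : MPEquivRel μ}

/-- A dense sequence allows to approximate every point, with the `k`-th approximation taken among
the first `k + 1` terms. -/
theorem exists_tendsto_of_denseRange {Y : Type*} [PseudoMetricSpace Y] {u : ℕ → Y}
    (hu : DenseRange u) : ∃ c : ℕ → Y → Y,
      (∀ k y, ∃ i ≤ k, c k y = u i) ∧ ∀ y, Tendsto (fun k => c k y) atTop (𝓝 y) := by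
  have key : ∀ k y, ∃ i ≤ k, ∀ j ≤ k, dist (u i) y ≤ dist (u j) y := fun k y => by
    obtain ⟨i, hi, h⟩ := Finset.exists_min_image (Finset.range (k + 1)) (fun i => dist (u i) y)
      ⟨0, by simp⟩
    exact ⟨i, by simpa [Nat.lt_succ_iff] using hi, fun j hj => h j (by simpa [Nat.lt_succ_iff])⟩
  choose i hi hmin using key
  refine ⟨fun k y => u (i k y), fun k y => ⟨i k y, hi k y, rfl⟩, fun y => ?_⟩
  rw [Metric.tendsto_atTop]
  intro ε hε
  obtain ⟨j, hj⟩ := Metric.mem_closure_range_iff.1 (hu y) ε hε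
  exact ⟨j, fun k hk => (hmin k y j hk).trans_lt (by rwa [dist_comm])⟩

/-- `θ` is `s` on arbitrarily chosen Borel representatives. The representative of a product and the
product of representatives are at distance `0`, hence so are their images, which gives
multiplicativity in the quotient. -/
theorem exists_isometry_of_tendsto {U : Ultrafilter ℕ} {n : ℕ → ℕ}
    (s : BorelAut R → SymProd U n)
    (hm : ∀ g h, dist (s (g * h)) (s g * s h) = 0) (hd : ∀ g h, dist (s g) (s h) = dist g h) :
    ∃ θ : FullGroup R →* SymUltraproduct U n, Isometry θ := by
  choose r hr using BorelAut.toFullGroup_surjective (R := R)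
  have hmul : ∀ x y, SeparationQuotient.mk (s (r (x * y))) =
      SeparationQuotient.mk (s (r x)) * SeparationQuotient.mk (s (r y)) := fun x y => by
    rw [← SeparationQuotient.mk_mul, SeparationQuotient.mk_eq_mk, Metric.inseparable_iff]
    refine le_antisymm ?_ dist_nonneg
    refine (dist_triangle _ (s (r x * r y)) _).trans ?_
    rw [hm, hd, ← BorelAut.dist_toFullGroup, map_mul, hr, hr, hr, dist_self, zero_add]
  let θ : FullGroup R →* SymUltraproduct U n :=
    { toFun := fun x => SeparationQuotient.mk (s (r x))
      map_one' := by
        have := hmul 1 1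
        rwa [mul_one, left_eq_mul] at this
      map_mul' := hmul }
  refine ⟨θ, Isometry.of_dist_eq fun x y => ?_⟩
  change dist (SeparationQuotient.mk _) (SeparationQuotient.mk _) = _
  rw [SeparationQuotient.dist_mk, hd, ← BorelAut.dist_toFullGroup, hr, hr]

/-- The `k`-th coordinate of `g` is the `k`-th almost homomorphism at an approximation `c k g` from
the first `k + 1` terms of a dense sequence. Its errors are below `1 / (k + 1)` and vanish along the
free ultrafilter. -/
theorem IsSofic.exists_isometry [StandardBorelSpace X] (hS : IsSofic R) (U : Ultrafilter ℕ)
    (hU : (U : Filter ℕ) ≤ cofinite) :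
    ∃ n : ℕ → ℕ, (∀ k, 0 < n k) ∧ ∃ θ : FullGroup R →* SymUltraproduct U n, Isometry θ := by
  classical
  obtain ⟨u, hu⟩ := BorelAut.exists_denseSeq R
  obtain ⟨c, hc, hlim⟩ := exists_tendsto_of_denseRange hu
  set K : ℕ → Finset (BorelAut R) := fun k =>
    (Finset.range (k + 1)).image u ∪
      Finset.image₂ (fun i j => u i * u j) (Finset.range (k + 1)) (Finset.range (k + 1)) with hK
  have hcK : ∀ k g, c k g ∈ K k := fun k g => by
    obtain ⟨i, hi, h⟩ := hc k g
    rw [h]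
    exact Finset.mem_union_left _ (Finset.mem_image_of_mem _ (by simpa [Nat.lt_succ_iff]))
  have hccK : ∀ k g h, c k g * c k h ∈ K k := fun k g h => by
    obtain ⟨i, hi, e⟩ := hc k g
    obtain ⟨j, hj, e'⟩ := hc k h
    rw [e, e']
    exact Finset.mem_union_right _ (Finset.mem_image₂.2
      ⟨i, by simpa [Nat.lt_succ_iff], j, by simpa [Nat.lt_succ_iff], rfl⟩)
  choose n hn σ hσm hσd using fun k : ℕ => hS.exists_perm (K k) (ε := 1 / (k + 1)) (by positivity)
  have hUtop : (U : Filter ℕ) ≤ atTop := by rwa [Nat.cofinite_eq_atTop] at hU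
  have hε : Tendsto (fun k : ℕ => 1 / ((k : ℝ) + 1)) U (𝓝 0) :=
    tendsto_one_div_add_atTop_nhds_zero_nat.mono_left hUtop
  have hcU : ∀ g, Tendsto (fun k => c k g) U (𝓝 g) := fun g => (hlim g).mono_left hUtop
  set s : BorelAut R → SymProd U n := fun g k => σ k (c k g) with hs
  refine ⟨n, hn, exists_isometry_of_tendsto s (fun g h => ?_) fun g h => ?_⟩
  -- The approximations are multiplicative only in the limit. Almost isometry of `σ k` carries this
  -- defect over, which is why `K k` contains products.
  · have h1 : Tendsto (fun k => dist (c k (g * h)) (c k g * c k h)) U (𝓝 0) := by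
      have h2 : Tendsto (fun k => dist (c k (g * h)) (g * h) + (dist g (c k g) + dist h (c k h))) U
          (𝓝 (dist (g * h) (g * h) + (dist g g + dist h h))) :=
        ((hcU _).dist tendsto_const_nhds).add
          ((tendsto_const_nhds.dist (hcU g)).add (tendsto_const_nhds.dist (hcU h)))
      simp only [dist_self, add_zero] at h2
      refine squeeze_zero (fun k => dist_nonneg) (fun k => ?_) h2
      refine (dist_triangle _ (g * h) _).trans ?_
      gcongr
      exact BorelAut.dist_mul_le _ _ _ _
    have h3 := (h1.add hε).add hε
    simp only [add_zero] at h3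
    refine tendsto_nhds_unique (SymProd.tendsto_dist _ _)
      (squeeze_zero (fun k => (SymProd.distSeq_mem _ _ k).1) (fun k => ?_) h3)
    have h4 := normHamming_triangle (σ k (c k (g * h))) (σ k (c k g * c k h))
      (σ k (c k g) * σ k (c k h) : Equiv.Perm (Fin (n k)))
    have h5 := hσm k _ (hcK k g) _ (hcK k h)
    have h6 := abs_lt.1 (hσd k _ (hcK k (g * h)) _ (hccK k g h))
    change normHamming (σ k (c k (g * h))) (σ k (c k g) * σ k (c k h) : Equiv.Perm (Fin (n k))) ≤ _
    linarith
  · have h1 : Tendsto (fun k => dist (c k g) (c k h)) U (𝓝 (dist g h)) := (hcU g).dist (hcU h)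
    have h2 : Tendsto (fun k => dist (c k g) (c k h) - SymProd.distSeq (s g) (s h) k) U (𝓝 0) :=
      squeeze_zero_norm (fun k => (hσd k _ (hcK k g) _ (hcK k h)).le) hε
    have h3 := h1.sub h2
    simp only [sub_sub_cancel, sub_zero] at h3
    exact tendsto_nhds_unique (SymProd.tendsto_dist _ _) h3

end Embedding

/-! ### Asymptotic densities -/

section Density

variable {n : ℕ → ℕ}

/-- The proportion of the points of `Fin (n k)` that lie in `S`. -/
noncomputable def density (S : Set (Σ k, Fin (n k))) (k : ℕ) : ℝ :=
  ({i | (⟨k, i⟩ : Σ k, Fin (n k)) ∈ S}.ncard : ℝ) / n k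

theorem density_nonneg (S : Set (Σ k, Fin (n k))) (k : ℕ) : 0 ≤ density S k := by
  unfold density
  positivity

theorem density_mono {S T : Set (Σ k, Fin (n k))} (h : S ⊆ T) (k : ℕ) :
    density S k ≤ density T k := by
  unfold density
  refine div_le_div_of_nonneg_right ?_ (Nat.cast_nonneg _)
  exact Nat.cast_le.2 (Set.ncard_le_ncard fun i hi => h hi)

theorem density_union_add_inter (S T : Set (Σ k, Fin (n k))) (k : ℕ) :
    density (S ∪ T) k + density (S ∩ T) k = density S k + density T k := by
  simp only [density, ← add_div]
  congr 1
  exact_mod_cast Set.ncard_union_add_ncard_inter {i | (⟨k, i⟩ : Σ k, Fin (n k)) ∈ S}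
    {i | (⟨k, i⟩ : Σ k, Fin (n k)) ∈ T}

theorem density_union_le (S T : Set (Σ k, Fin (n k))) (k : ℕ) :
    density (S ∪ T) k ≤ density S k + density T k := by
  linarith [density_union_add_inter S T k, density_nonneg (S ∩ T) k]

theorem density_empty (k : ℕ) : density (∅ : Set (Σ k, Fin (n k))) k = 0 := by
  simp [density]

theorem density_univ {k : ℕ} (hn : 0 < n k) : density (Set.univ : Set (Σ k, Fin (n k))) k = 1 := by
  have : (n k : ℝ) ≠ 0 := by exact_mod_cast hn.ne'
  simp [density, Set.ncard_univ, this]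

theorem density_preimage (σ : ∀ k, Equiv.Perm (Fin (n k))) (S : Set (Σ k, Fin (n k))) (k : ℕ) :
    density {p | (⟨p.1, σ p.1 p.2⟩ : Σ k, Fin (n k)) ∈ S} k = density S k := by
  unfold density
  congr 2
  exact Set.ncard_preimage_of_injective_subset_range (s := {i | (⟨k, i⟩ : Σ k, Fin (n k)) ∈ S})
    (σ k).injective (by rw [(σ k).surjective.range_eq]; exact Set.subset_univ _)

theorem density_ne {β : ℕ → Type} [∀ k, DecidableEq (β k)] (x y : ∀ k, Fin (n k) → β k) (k : ℕ) :
    density {p | x p.1 p.2 ≠ y p.1 p.2} k = normHamming (x k) (y k) := by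
  unfold density normHamming hammingDist
  congr 2
  rw [Set.ncard_eq_toFinset_card']
  congr 1
  ext i
  simp

variable (U : Ultrafilter ℕ)

/-- The filter of sets whose complement has density tending to zero along `U`. -/
def conull (n : ℕ → ℕ) : Filter (Σ k, Fin (n k)) where
  sets := {S | Tendsto (density Sᶜ) U (𝓝 0)}
  univ_sets := by
    simp only [Set.mem_ofPred_eq, Set.compl_univ, funext density_empty]
    exact tendsto_const_nhds
  sets_of_superset {S T} hS hST :=
    squeeze_zero (fun k => density_nonneg _ k)
      (fun k => density_mono (Set.compl_subset_compl.2 hST) k) hS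
  inter_sets {S T} hS hT := by
    have := Tendsto.add hS hT
    rw [add_zero] at this
    refine squeeze_zero (fun k => density_nonneg _ k) (fun k => ?_) this
    rw [Set.compl_inter]
    exact density_union_le _ _ k

/-- The density of `S` tends to `a` along `U`. -/
def HasDensity (S : Set (Σ k, Fin (n k))) (a : ℝ) : Prop := Tendsto (density S) U (𝓝 a)

variable {U}

theorem eventually_conull {P : (Σ k, Fin (n k)) → Prop} :
    (∀ᶠ p in conull U n, P p) ↔ HasDensity U {p | ¬ P p} 0 := Iff.rfl

theorem HasDensity.congr {S T : Set (Σ k, Fin (n k))} {a : ℝ} (hS : HasDensity U S a)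
    (h : ∀ᶠ p in conull U n, p ∈ S ↔ p ∈ T) : HasDensity U T a := by
  have h' := eventually_conull.1 h
  have : Tendsto (fun k => density T k - density S k) U (𝓝 0) := by
    refine squeeze_zero_norm (fun k => ?_) h'
    rw [Real.norm_eq_abs, abs_sub_le_iff]
    constructor <;> rw [sub_le_iff_le_add, add_comm] <;>
    · refine (density_mono ?_ k).trans (density_union_le _ _ k)
      intro p hp
      simp only [Set.mem_union, Set.mem_ofPred_eq]
      tauto
  have h2 := Tendsto.add this hS
  simp only [sub_add_cancel, zero_add] at h2
  exact h2

theorem HasDensity.union {S T : Set (Σ k, Fin (n k))} {a b : ℝ} (hS : HasDensity U S a)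
    (hT : HasDensity U T b) (h : ∀ᶠ p in conull U n, p ∈ S → p ∉ T) :
    HasDensity U (S ∪ T) (a + b) := by
  have h' : HasDensity U (S ∩ T) 0 := by
    have := eventually_conull.1 h
    simp only [Classical.not_imp, not_not] at this
    exact this
  have h2 := (Tendsto.add hS hT).sub h'
  rw [sub_zero] at h2
  refine h2.congr fun k => ?_
  linarith [density_union_add_inter S T k]

/-- As for finite measures, an inclusion between sets of equal size is an equality modulo null sets.
This upgrades one-sided inclusions below. -/
theorem HasDensity.eventually_mem_of_mem {S T : Set (Σ k, Fin (n k))} {a : ℝ}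
    (hS : HasDensity U S a) (hT : HasDensity U T a) (h : ∀ᶠ p in conull U n, p ∈ S → p ∈ T) :
    ∀ᶠ p in conull U n, p ∈ T → p ∈ S := by
  have h' : HasDensity U (S \ T) 0 := by
    have := eventually_conull.1 h
    simp only [Classical.not_imp] at this
    exact this
  rw [eventually_conull]
  simp only [Classical.not_imp]
  have h2 := (Tendsto.add hT h').sub hS
  rw [add_zero, sub_self] at h2
  refine h2.congr fun k => ?_
  have e1 := density_union_add_inter T (S \ T) k
  have e2 := density_union_add_inter S (T \ S) k
  rw [Set.inter_sdiff_self, density_empty, Set.union_sdiff_self] at e1 e2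
  rw [Set.union_comm] at e1
  change _ = density (T \ S) k
  linarith

theorem tendsto_perm_conull (σ : ∀ k, Equiv.Perm (Fin (n k))) :
    Tendsto (fun p : Σ k, Fin (n k) => (⟨p.1, σ p.1 p.2⟩ : Σ k, Fin (n k))) (conull U n)
      (conull U n) := fun S hS => by
  change Tendsto (density {p | (⟨p.1, σ p.1 p.2⟩ : Σ k, Fin (n k)) ∈ Sᶜ}) U (𝓝 0)
  simp only [funext (density_preimage σ Sᶜ)]
  exact hS

end Density

/-! ### Isometric embeddings of the full group in ultraproducts of symmetric groups -/

/-- An isometric map from the full group to the product of symmetric groups, multiplicative up to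
distance zero. -/
structure SoficEmbedding {X : Type*} [MeasurableSpace X] {μ : Measure X} [IsProbabilityMeasure μ]
    (R : MPEquivRel μ) (U : Ultrafilter ℕ) (n : ℕ → ℕ) where
  /-- The underlying map. -/
  toFun : BorelAut R → SymProd U n
  pos : ∀ k, 0 < n k
  dist_map_mul : ∀ g h, dist (toFun (g * h)) (toFun g * toFun h) = 0
  dist_map : ∀ g h, dist (toFun g) (toFun h) = dist g h

namespace SoficEmbedding

variable {X : Type*} [MeasurableSpace X] {μ : Measure X} [IsProbabilityMeasure μ]
  {R : MPEquivRel μ} {U : Ultrafilter ℕ} {n : ℕ → ℕ}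

theorem nonempty_of_isometry (hn : ∀ k, 0 < n k) {θ : FullGroup R →* SymUltraproduct U n}
    (hθ : Isometry θ) : Nonempty (SoficEmbedding R U n) := by
  choose s hs using fun g : BorelAut R =>
    SeparationQuotient.surjective_mk (θ (BorelAut.toFullGroup g))
  refine ⟨⟨s, hn, fun g h => ?_, fun g h => ?_⟩⟩
  · rw [← SeparationQuotient.dist_mk, SeparationQuotient.mk_mul, hs, hs, hs, map_mul, map_mul,
      dist_self]
  · rw [← SeparationQuotient.dist_mk, hs, hs, hθ.dist_eq, BorelAut.dist_toFullGroup]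

variable (s : SoficEmbedding R U n)

/-- The permutation of the disjoint union of the sets `Fin (n k)` given by `g`. -/
def act (g : BorelAut R) (p : Σ k, Fin (n k)) : Σ k, Fin (n k) := ⟨p.1, s.toFun g p.1 p.2⟩

theorem act_eq_act {g h : BorelAut R} {p : Σ k, Fin (n k)} :
    s.act g p = s.act h p ↔ s.toFun g p.1 p.2 = s.toFun h p.1 p.2 := by
  simp [act]

theorem act_injective (g : BorelAut R) : Function.Injective (s.act g) := by
  rintro ⟨k, i⟩ ⟨l, j⟩ h
  obtain rfl : k = l := congrArg Sigma.fst h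
  have h : s.toFun g k i = s.toFun g k j := by simpa [act] using h
  rw [(s.toFun g k).injective h]

theorem tendsto_act (g : BorelAut R) : Tendsto (s.act g) (conull U n) (conull U n) :=
  tendsto_perm_conull (s.toFun g)

theorem hasDensity_act_ne (g h : BorelAut R) :
    HasDensity U {p | s.act g p ≠ s.act h p} (μ.real {x | g x ≠ h x}) := by
  rw [← BorelAut.dist_eq, ← s.dist_map]
  refine (SymProd.tendsto_dist (s.toFun g) (s.toFun h)).congr fun k => ?_
  simp only [ne_eq, act_eq_act]
  exact (density_ne (fun k => ⇑(s.toFun g k)) (fun k => ⇑(s.toFun h k)) k).symm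

theorem act_mul (g h : BorelAut R) :
    ∀ᶠ p in conull U n, s.act (g * h) p = s.act g (s.act h p) := by
  rw [eventually_conull, ← s.dist_map_mul g h]
  refine (SymProd.tendsto_dist _ _).congr fun k => ?_
  refine Eq.trans (density_ne (fun k => ⇑(s.toFun (g * h) k))
    (fun k => ⇑((s.toFun g * s.toFun h) k)) k).symm ?_
  congr 1
  ext p
  refine not_congr ?_
  simp only [act, Sigma.mk.injEq, heq_eq_eq, true_and]
  rfl

/-- An injective map that is almost everywhere idempotent is almost everywhere the identity. -/
theorem act_one : ∀ᶠ p in conull U n, s.act 1 p = p := by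
  filter_upwards [s.act_mul 1 1] with p hp
  rw [mul_one] at hp
  exact (s.act_injective 1 hp).symm

theorem hasDensity_act_ne_self (g : BorelAut R) :
    HasDensity U {p | s.act g p ≠ p} (μ.real {x | g x ≠ x}) := by
  refine (s.hasDensity_act_ne g 1).congr ?_
  filter_upwards [s.act_one] with p hp
  simp only [hp]

/-- Automorphisms with disjoint supports act with disjoint supports. -/
theorem eventually_act_eq_or [StandardBorelSpace X] {g h : BorelAut R}
    (hgh : ∀ᵐ x ∂μ, g x = x ∨ h x = x) :
    ∀ᶠ p in conull U n, s.act g p = p ∨ s.act h p = p := by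
  have hg := s.hasDensity_act_ne_self g
  have hh := s.hasDensity_act_ne_self h
  -- The support of the action of `g * h` lies asymptotically in the union of the two supports, and
  -- by isometry has their total density. Hence the intersection of the supports has density zero.
  have hm : μ.real {x | (g * h) x ≠ x} = μ.real {x | g x ≠ x} + μ.real {x | h x ≠ x} := by
    have hae : {x | (g * h) x ≠ x} =ᵐ[μ] ({x | g x ≠ x} ∪ {x | h x ≠ x} : Set X) := by
      filter_upwards [hgh, h.measurePreserving.quasiMeasurePreserving.ae hgh] with x hx hx'
      apply propext
      change (g (h x) ≠ x) ↔ (g x ≠ x ∨ h x ≠ x)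
      by_cases hhx : h x = x
      · rw [hhx]
        tauto
      · have h1 : h (h x) ≠ h x := fun e => hhx (h.injective e)
        rw [hx'.resolve_right h1]
        tauto
    refine (measureReal_congr hae).trans
      (measureReal_union₀ (BorelAut.measurableSet_ne h 1).nullMeasurableSet ?_)
    rw [AEDisjoint, measure_eq_zero_iff_ae_notMem]
    filter_upwards [hgh] with x hx hx'
    exact hx.elim hx'.1 hx'.2
  have hgh' := s.hasDensity_act_ne_self (g * h)
  have hsub : ∀ᶠ p in conull U n, p ∈ {p | s.act (g * h) p ≠ p} →
      p ∈ {p | s.act g p ≠ p} ∪ {p | s.act h p ≠ p} := by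
    filter_upwards [s.act_mul g h] with p hp hne
    by_contra hcon
    simp only [Set.mem_union, Set.mem_ofPred_eq, not_or, not_not] at hcon
    exact hne (by rw [hp, hcon.2, hcon.1])
  rw [eventually_conull]
  have h0 : HasDensity U ({p | s.act (g * h) p ≠ p} \
      ({p | s.act g p ≠ p} ∪ {p | s.act h p ≠ p})) 0 := by
    have := eventually_conull.1 hsub
    simp only [Classical.not_imp] at this
    exact this
  have hlim := ((Tendsto.add hg hh).sub hgh').add h0
  rw [hm, sub_self, add_zero] at hlim
  refine squeeze_zero (fun k => density_nonneg _ k) (fun k => ?_) hlim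
  have e1 := density_union_add_inter {p | s.act g p ≠ p} {p | s.act h p ≠ p} k
  have e2 : density {p | s.act (g * h) p ≠ p} k ≤
      density ({p | s.act g p ≠ p} ∪ {p | s.act h p ≠ p}) k +
        density ({p | s.act (g * h) p ≠ p} \ ({p | s.act g p ≠ p} ∪ {p | s.act h p ≠ p})) k := by
    refine (density_mono ?_ k).trans (density_union_le _ _ k)
    rw [Set.union_sdiff_self]
    exact Set.subset_union_right
  have e3 : {p | ¬(s.act g p = p ∨ s.act h p = p)} =
      {p | s.act g p ≠ p} ∩ {p | s.act h p ≠ p} := by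
    ext p
    simp
  rw [e3]
  linarith

/-- The set in the disjoint union of the sets `Fin (n k)` corresponding to a set in `X`: the support
of the permutation given by an automorphism with support `A`. -/
def region (A : Set X) : Set (Σ k, Fin (n k)) :=
  {p | ∃ h : ∃ g : BorelAut R, ∀ᵐ x ∂μ, g x ≠ x ↔ x ∈ A, s.act h.choose p ≠ p}

/-! ### Regions as an asymptotic copy of the measure algebra -/

section Region

variable [StandardBorelSpace X] (hR : IsAperiodic R) {A B : Set X}
include hR

theorem exists_region_eq (hA : MeasurableSet A) :
    ∃ g : BorelAut R, (∀ᵐ x ∂μ, g x ≠ x ↔ x ∈ A) ∧ s.region A = {p | s.act g p ≠ p} := by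
  have h := hR.exists_support hA
  refine ⟨h.choose, h.choose_spec, ?_⟩
  ext p
  exact ⟨fun ⟨_, hp⟩ => hp, fun hp => ⟨h, hp⟩⟩

theorem hasDensity_region (hA : MeasurableSet A) : HasDensity U (s.region A) (μ.real A) := by
  obtain ⟨g, hg, h⟩ := s.exists_region_eq hR hA
  have : μ.real A = μ.real {x | g x ≠ x} :=
    measureReal_congr (by filter_upwards [hg] with x hx using propext hx.symm)
  rw [h, this]
  exact s.hasDensity_act_ne_self g

/-- An automorphism with support `A` has support disjoint from that of `g`, and disjointness passes
to the actions. -/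
theorem act_eq_self (hA : MeasurableSet A) {g : BorelAut R} (h : ∀ᵐ x ∂μ, x ∈ A → g x = x) :
    ∀ᶠ p in conull U n, p ∈ s.region A → s.act g p = p := by
  obtain ⟨a, ha, e⟩ := s.exists_region_eq hR hA
  have : ∀ᵐ x ∂μ, g x = x ∨ a x = x := by
    filter_upwards [h, ha] with x hx hx'
    tauto
  filter_upwards [s.eventually_act_eq_or this] with p hp hpA
  rw [e] at hpA
  exact hp.resolve_right hpA

theorem region_disjoint (hA : MeasurableSet A) (hB : MeasurableSet B) (h : Disjoint A B) :
    ∀ᶠ p in conull U n, p ∈ s.region A → p ∉ s.region B := by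
  obtain ⟨b, hb, e⟩ := s.exists_region_eq hR hB
  have : ∀ᵐ x ∂μ, x ∈ A → b x = x := by
    filter_upwards [hb] with x hx hxA
    by_contra hne
    exact Set.disjoint_left.1 h hxA (hx.1 hne)
  filter_upwards [s.act_eq_self hR hA this] with p hp hpA
  rw [e]
  exact fun hne => hne (hp hpA)

theorem act_congr (hA : MeasurableSet A) {g h : BorelAut R} (hgh : ∀ x ∈ A, g x = h x) :
    ∀ᶠ p in conull U n, p ∈ s.region A → s.act g p = s.act h p := by
  have : ∀ᵐ x ∂μ, x ∈ A → (g⁻¹ * h) x = x := Eventually.of_forall fun x hx => by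
    rw [BorelAut.mul_apply, ← hgh x hx, BorelAut.inv_apply_self]
  filter_upwards [s.act_eq_self hR hA this, s.act_mul g (g⁻¹ * h)] with p hp hm hpA
  rw [mul_inv_cancel_left, hp hpA] at hm
  exact hm.symm

/-- The two regions are asymptotically disjoint and their densities add up to `1`. -/
theorem mem_region_or_compl (hA : MeasurableSet A) :
    ∀ᶠ p in conull U n, p ∈ s.region A ∨ p ∈ s.region Aᶜ := by
  have h := (s.hasDensity_region hR hA).union (s.hasDensity_region hR hA.compl)
    (s.region_disjoint hR hA hA.compl disjoint_compl_right)
  rw [probReal_add_probReal_compl hA] at h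
  have huniv : HasDensity U (Set.univ : Set (Σ k, Fin (n k))) 1 := by
    refine tendsto_const_nhds.congr fun k => (density_univ (s.pos k)).symm
  filter_upwards [h.eventually_mem_of_mem huniv (Eventually.of_forall fun _ _ => trivial)]
    with p hp using hp trivial

theorem region_mono (hA : MeasurableSet A) (hB : MeasurableSet B) (h : A ⊆ B) :
    ∀ᶠ p in conull U n, p ∈ s.region A → p ∈ s.region B := by
  filter_upwards [s.mem_region_or_compl hR hB, s.region_disjoint hR hA hB.compl
    (Set.disjoint_compl_right_iff_subset.2 h)] with p h1 h2 h3
  exact h1.resolve_right (h2 h3)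

/-- The regions of `A ∩ B` and `A \ B` lie in that of `A` and have its total density, so they
exhaust it; the second avoids the region of `B`. -/
theorem region_inter (hA : MeasurableSet A) (hB : MeasurableSet B) :
    ∀ᶠ p in conull U n, p ∈ s.region A → p ∈ s.region B → p ∈ s.region (A ∩ B) := by
  have h := (s.hasDensity_region hR (hA.inter hB)).union (s.hasDensity_region hR (hA.diff hB))
    (s.region_disjoint hR (hA.inter hB) (hA.diff hB)
      (Set.disjoint_sdiff_right.mono_left Set.inter_subset_right))
  rw [measureReal_inter_add_sdiff hB] at h
  have hsub : ∀ᶠ p in conull U n,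
      p ∈ s.region (A ∩ B) ∪ s.region (A \ B) → p ∈ s.region A := by
    filter_upwards [s.region_mono hR (hA.inter hB) hA Set.inter_subset_left,
      s.region_mono hR (hA.diff hB) hA Set.sdiff_subset] with p h1 h2 h3
    exact h3.elim h1 h2
  filter_upwards [h.eventually_mem_of_mem (s.hasDensity_region hR hA) hsub,
    s.region_disjoint hR (hA.diff hB) hB Set.disjoint_sdiff_left] with p h1 h2 hpA hpB
  exact (h1 hpA).resolve_right fun h3 => h2 h3 hpB

theorem notMem_region_empty : ∀ᶠ p in conull U n, p ∉ s.region (∅ : Set X) := by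
  filter_upwards [s.region_disjoint hR MeasurableSet.empty MeasurableSet.empty
    (Set.disjoint_empty ∅)] with p hp h
  exact hp h h

/-- A property that holds almost everywhere on each set of a finite Borel cover holds almost
everywhere. -/
theorem eventually_of_cover {ι : Type*} [Finite ι] {A : ι → Set X}
    (hA : ∀ i, MeasurableSet (A i)) (hcov : ∀ x, ∃ i, x ∈ A i) {P : (Σ k, Fin (n k)) → Prop}
    (h : ∀ i, ∀ᶠ p in conull U n, p ∈ s.region (A i) → P p) : ∀ᶠ p in conull U n, P p := by
  classical
  have := Fintype.ofFinite ι
  have key : ∀ t : Finset ι, ∀ᶠ p in conull U n, P p ∨ p ∈ s.region (⋂ i ∈ t, (A i)ᶜ) := by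
    intro t
    induction t using Finset.induction_on with
    | empty =>
      filter_upwards [s.mem_region_or_compl hR MeasurableSet.univ, s.notMem_region_empty hR]
        with p h1 h2
      rw [Set.compl_univ] at h1
      right
      simpa using h1.resolve_right h2
    | insert i t _ ih =>
      have hm : MeasurableSet (⋂ j ∈ t, (A j)ᶜ) :=
        Finset.measurableSet_biInter t fun j _ => (hA j).compl
      filter_upwards [ih, h i, s.mem_region_or_compl hR (hA i),
        s.region_inter hR (hA i).compl hm] with p h1 h2 h3 h4
      rw [Finset.set_biInter_insert]
      tauto
  filter_upwards [key Finset.univ, s.notMem_region_empty hR] with p h1 h2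
  refine h1.resolve_right ?_
  convert h2 using 3
  rw [Set.eq_empty_iff_forall_notMem]
  intro x hx
  obtain ⟨i, hi⟩ := hcov x
  simp only [Finset.mem_univ, Set.iInter_true, Set.mem_iInter] at hx
  exact hx i hi

/-- If `a` has support `g ⁻¹' A`, the conjugate `g * a * g⁻¹` is trivial off `A`. Were the image of
`p` in the region of `Aᶜ`, the conjugate would fix it, so `a` would fix `p`. -/
theorem act_mem_region (hA : MeasurableSet A) (g : BorelAut R) :
    ∀ᶠ p in conull U n, p ∈ s.region (g ⁻¹' A) → s.act g p ∈ s.region A := by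
  obtain ⟨a, ha, e⟩ := s.exists_region_eq hR (g.measurable hA)
  have hae : ∀ᵐ x ∂μ, x ∈ Aᶜ → (g * a * g⁻¹) x = x := by
    filter_upwards [g⁻¹.measurePreserving.quasiMeasurePreserving.ae ha] with x hx hxA
    have h1 : g⁻¹ x ∉ g ⁻¹' A := by
      rwa [Set.mem_preimage, BorelAut.apply_inv_self]
    have h2 : a (g⁻¹ x) = g⁻¹ x := by
      by_contra hne
      exact h1 (hx.1 hne)
    rw [BorelAut.mul_apply, BorelAut.mul_apply, h2, BorelAut.apply_inv_self]
  filter_upwards [(s.tendsto_act g).eventually (s.act_eq_self hR hA.compl hae),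
    (s.tendsto_act g).eventually (s.mem_region_or_compl hR hA), s.act_mul (g * a * g⁻¹) g,
    s.act_mul g a] with p h1 h2 h3 h4 hp
  rw [e] at hp
  refine h2.resolve_right fun h5 => hp ?_
  rw [inv_mul_cancel_right, h1 h5, h4] at h3
  exact s.act_injective g h3

theorem map_congr (hA : MeasurableSet A) {c c' : Option (BorelAut R)}
    (h : ∀ x ∈ A, c.map (fun g => g x) = c'.map fun g => g x) :
    ∀ᶠ p in conull U n, p ∈ s.region A →
      c.map (fun g => s.toFun g p.1 p.2) = c'.map fun g => s.toFun g p.1 p.2 := by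
  have hempty : A = ∅ → ∀ᶠ p in conull U n, p ∉ s.region A := fun h =>
    h ▸ s.notMem_region_empty hR
  rcases c with _ | g <;> rcases c' with _ | g'
  · exact Eventually.of_forall fun p _ => rfl
  · filter_upwards [hempty (Set.eq_empty_of_forall_notMem fun x hx => by simpa using h x hx)]
      with p hp hp' using (hp hp').elim
  · filter_upwards [hempty (Set.eq_empty_of_forall_notMem fun x hx => by simpa using h x hx)]
      with p hp hp' using (hp hp').elim
  · filter_upwards [s.act_congr hR hA (g := g) (h := g') fun x hx => by simpa using h x hx]
      with p hp hpA
    exact congrArg some (s.act_eq_act.1 (hp hpA))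

/-- The set where two actions differ lies in the region of `{g ≠ g'}` and, by isometry, has the same
density, so it fills that region. -/
theorem map_ne (hA : MeasurableSet A) {c c' : Option (BorelAut R)}
    (h : ∀ x ∈ A, c.map (fun g => g x) ≠ c'.map fun g => g x) :
    ∀ᶠ p in conull U n, p ∈ s.region A →
      c.map (fun g => s.toFun g p.1 p.2) ≠ c'.map fun g => s.toFun g p.1 p.2 := by
  rcases c with _ | g <;> rcases c' with _ | g'
  · have : A = ∅ := Set.eq_empty_of_forall_notMem fun x hx => h x hx rfl
    rw [this]
    filter_upwards [s.notMem_region_empty hR] with p hp hp' using (hp hp').elim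
  · exact Eventually.of_forall fun p _ => by simp
  · exact Eventually.of_forall fun p _ => by simp
  · have hD := BorelAut.measurableSet_ne g g'
    have hsub : ∀ᶠ p in conull U n, p ∈ {p | s.act g p ≠ s.act g' p} →
        p ∈ s.region {x | g x ≠ g' x} := by
      filter_upwards [s.mem_region_or_compl hR hD, s.act_congr hR hD.compl (g := g) (h := g')
        fun x hx => by simpa using hx] with p h1 h2 h3
      exact h1.resolve_right fun h4 => h3 (h2 h4)
    filter_upwards [(s.hasDensity_act_ne g g').eventually_mem_of_mem (s.hasDensity_region hR hD)
      hsub, s.region_mono hR hA hD fun x hx => by simpa using h x hx] with p h1 h2 hpA heq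
    exact h1 (h2 hpA) (s.act_eq_act.2 (Option.some_injective _ heq))

end Region

end SoficEmbedding

/-! ### Simple elements of the full semigroup -/

section Simple

variable {X : Type*} [MeasurableSpace X] {μ : Measure X} {R : MPEquivRel μ}

/-- A partial bijection of `X` is simple if there is a finite Borel partition of `X` such that on
each piece it is undefined or agrees with an element of the full group. -/
def IsSimple (R : MPEquivRel μ) (φ : X ≃. X) : Prop :=
  ∃ (ι : Type) (_ : Finite ι) (A : ι → Set X) (c : ι → Option (BorelAut R)),
    (∀ i, MeasurableSet (A i)) ∧ (∀ x, ∃ i, x ∈ A i) ∧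
      ∀ i, ∀ x ∈ A i, φ x = (c i).map fun g => g x

theorem isSimple_refl : IsSimple R (PEquiv.refl X) :=
  ⟨Unit, inferInstance, fun _ => Set.univ, fun _ => some 1, fun _ => MeasurableSet.univ,
    fun _ => ⟨(), trivial⟩, fun _ _ _ => rfl⟩

theorem isSimple_bot : IsSimple R (⊥ : X ≃. X) :=
  ⟨Unit, inferInstance, fun _ => Set.univ, fun _ => none, fun _ => MeasurableSet.univ,
    fun _ => ⟨(), trivial⟩, fun _ _ _ => rfl⟩

/-- The pieces of the inverse are the images of the pieces, with one extra piece, of index `none`,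
off the range. -/
theorem IsSimple.symm {φ : X ≃. X} (h : IsSimple R φ) : IsSimple R φ.symm := by
  obtain ⟨ι, _, A, c, hA, hcov, hφ⟩ := h
  have hm : ∀ i, MeasurableSet {y | ∃ g ∈ c i, y ∈ (g : X → X) '' A i} := fun i => by
    rcases h : c i with _ | g
    · simp
    · convert g.measurableSet_image (hA i) using 1
      ext y
      refine ⟨?_, fun hy => ⟨g, rfl, hy⟩⟩
      rintro ⟨g', hg', hy⟩
      obtain rfl : g = g' := Option.some_injective _ hg'
      exact hy
  refine ⟨Option ι, inferInstance,
    fun o => o.elim (⋃ i, {y | ∃ g ∈ c i, y ∈ (g : X → X) '' A i})ᶜ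
      fun i => {y | ∃ g ∈ c i, y ∈ (g : X → X) '' A i},
    fun o => o.elim none fun i => (c i).map fun g => g⁻¹, ?_, fun y => ?_, ?_⟩
  · rintro (_ | i)
    · exact (MeasurableSet.iUnion hm).compl
    · exact hm i
  · by_cases hy : y ∈ ⋃ i, {y | ∃ g ∈ c i, y ∈ (g : X → X) '' A i}
    · obtain ⟨i, hi⟩ := Set.mem_iUnion.1 hy
      exact ⟨some i, hi⟩
    · exact ⟨none, hy⟩
  · rintro (_ | i) y hy
    · change φ.symm y = none
      rw [Option.eq_none_iff_forall_ne_some]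
      intro x hx
      rw [PEquiv.eq_some_iff] at hx
      obtain ⟨i, hi⟩ := hcov x
      rw [hφ i x hi] at hx
      obtain ⟨g, hg, hgx⟩ := Option.map_eq_some_iff.1 hx
      exact hy (Set.mem_iUnion.2 ⟨i, g, hg, x, hi, hgx⟩)
    · obtain ⟨g, hg, x, hx, rfl⟩ := hy
      have hg : c i = some g := hg
      have h1 : φ x = some (g x) := by rw [hφ i x hx, hg]; rfl
      change φ.symm (g x) = ((c i).map fun g => g⁻¹).map fun h => h (g x)
      rw [hg, φ.eq_some_iff.2 h1]
      exact congrArg some (g.inv_apply_self x).symm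

theorem IsSimple.trans {φ ψ : X ≃. X} (hφ : IsSimple R φ) (hψ : IsSimple R ψ) :
    IsSimple R (ψ.trans φ) := by
  obtain ⟨ι, _, A, c, hA, hAcov, hφ⟩ := hφ
  obtain ⟨κ, _, B, d, hB, hBcov, hψ⟩ := hψ
  refine ⟨ι × κ, inferInstance, fun p => B p.2 ∩ {x | ∀ h ∈ d p.2, (h : X → X) x ∈ A p.1},
    fun p => (d p.2).bind fun h => (c p.1).map fun g => g * h, fun p => ?_, fun x => ?_, ?_⟩
  · refine (hB _).inter ?_
    rcases d p.2 with _ | h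
    · simp
    · convert h.measurable (hA p.1) using 1
      ext x
      refine ⟨fun hx => hx h rfl, fun hx h' hh' => ?_⟩
      obtain rfl : h = h' := Option.some_injective _ hh'
      exact hx
  · obtain ⟨j, hj⟩ := hBcov x
    rcases hd : d j with _ | h
    · obtain ⟨i, -⟩ := hAcov x
      exact ⟨(i, j), hj, by simp [hd]⟩
    · obtain ⟨i, hi⟩ := hAcov (h x)
      exact ⟨(i, j), hj, by simpa [hd] using hi⟩
  · rintro ⟨i, j⟩ x ⟨hx, hx'⟩
    change (ψ x).bind φ = _
    rw [hψ j x hx]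
    dsimp only
    rcases hd : d j with _ | h
    · rfl
    · have h1 := hφ i (h x) (hx' h hd)
      simp only [Option.map_some, Option.bind_some, h1, Option.map_map]
      rfl

theorem IsSimple.measurableSet_ne [StandardBorelSpace X] {φ ψ : X ≃. X} (hφ : IsSimple R φ)
    (hψ : IsSimple R ψ) : MeasurableSet {x | φ x ≠ ψ x} := by
  obtain ⟨ι, _, A, c, hA, hAcov, hφ⟩ := hφ
  obtain ⟨κ, _, B, d, hB, hBcov, hψ⟩ := hψ
  have : {x | φ x ≠ ψ x} = ⋃ i, ⋃ j, A i ∩ B j ∩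
      {x | (c i).map (fun g => g x) ≠ (d j).map fun g => g x} := by
    ext x
    simp only [Set.mem_ofPred_eq, Set.mem_iUnion, Set.mem_inter_iff]
    constructor
    · intro h
      obtain ⟨i, hi⟩ := hAcov x
      obtain ⟨j, hj⟩ := hBcov x
      exact ⟨i, j, ⟨hi, hj⟩, by rwa [← hφ i x hi, ← hψ j x hj]⟩
    · rintro ⟨i, j, ⟨hi, hj⟩, h⟩
      rwa [hφ i x hi, hψ j x hj]
  rw [this]
  refine MeasurableSet.iUnion fun i => MeasurableSet.iUnion fun j => ((hA i).inter (hB j)).inter ?_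
  rcases c i with _ | g <;> rcases d j with _ | h
  · simp
  · simp
  · simp
  · simpa using BorelAut.measurableSet_ne g h

/-- The partial identity of a Borel set. -/
noncomputable def BorelFullSemigroup.idOn (R : MPEquivRel μ) {A : Set X} (hA : MeasurableSet A) :
    BorelFullSemigroup R := by
  classical
  refine ⟨PEquiv.ofSet A, ⟨fun B hB => ?_, fun B hB => ?_⟩, fun x y h => ?_⟩
  · convert hA.inter hB using 1
    ext x
    refine ⟨?_, fun h => ⟨x, h.2, PEquiv.mem_ofSet_iff.2 ⟨rfl, h.1⟩⟩⟩
    rintro ⟨y, hy, h⟩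
    obtain ⟨rfl, hyA⟩ := PEquiv.mem_ofSet_iff.1 h
    exact ⟨hyA, hy⟩
  · convert hA.inter hB using 1
    ext x
    refine ⟨?_, fun h => ⟨x, h.2, PEquiv.mem_ofSet_iff.2 ⟨rfl, h.1⟩⟩⟩
    rintro ⟨y, hy, h⟩
    obtain ⟨rfl, hyA⟩ := PEquiv.mem_ofSet_iff.1 h
    exact ⟨hyA, hy⟩
  · rw [(PEquiv.mem_ofSet_iff.1 h).1]

theorem BorelFullSemigroup.mul_idOn_apply_of_mem (φ : BorelFullSemigroup R) {A : Set X}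
    (hA : MeasurableSet A) {x : X} (hx : x ∈ A) : (φ * idOn R hA).1 x = φ.1 x := by
  classical
  change (PEquiv.ofSet A x).bind φ.1 = _
  simp [PEquiv.ofSet_eq_some_self_iff.2 hx]

theorem BorelFullSemigroup.mul_idOn_apply_of_notMem (φ : BorelFullSemigroup R) {A : Set X}
    (hA : MeasurableSet A) {x : X} (hx : x ∉ A) : (φ * idOn R hA).1 x = none := by
  classical
  change (PEquiv.ofSet A x).bind φ.1 = _
  have : PEquiv.ofSet A x = none := by simp [PEquiv.ofSet, hx]
  rw [this]
  rfl

/-- Up to a null set, every element of the full semigroup agrees on countably many Borel pieces with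
elements of the full group. -/
theorem BorelFullSemigroup.exists_pieces [StandardBorelSpace X] (φ : BorelFullSemigroup R) :
    ∃ (A : ℕ → Set X) (g : ℕ → BorelAut R), (∀ n, MeasurableSet (A n)) ∧
      (∀ n, ∀ x ∈ A n, φ.1 x = some (g n x)) ∧ ∀ x ∈ φ.dom, ∃ n, x ∈ A n := by
  classical
  obtain ⟨W, hWm, hW⟩ := exists_seq_measurableSet_mem_notMem X
  have hdom := φ.measurableSet_dom
  -- Extending by the identity off the domain gives a total Borel map.
  set f : X → X := fun x => (φ.1 x).getD x with hf
  have hfdom : ∀ {x}, x ∈ φ.dom → φ.1 x = some (f x) := fun {x} hx => by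
    obtain ⟨y, hy⟩ := Option.isSome_iff_exists.1 (show (φ.1 x).isSome from hx)
    simp [hf, hy]
  have hfm : Measurable f := by
    intro B hB
    have : f ⁻¹' B = {x | ∃ y ∈ B, y ∈ φ.1 x} ∪ (φ.domᶜ ∩ B) := by
      ext x
      by_cases hx : x ∈ φ.dom
      · simp [hfdom hx, hx]
      · have hn : φ.1 x = none := by simpa [dom] using hx
        simp [hf, hn, hx]
    rw [this]
    exact (φ.2.1.1 B hB).union (hdom.compl.inter hB)
  have hinj : Set.InjOn f φ.dom := fun x hx y hy hxy => by
    have h1 : f x ∈ φ.1 x := hfdom hx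
    have h2 : f x ∈ φ.1 y := hxy ▸ hfdom hy
    exact φ.1.inj h1 h2
  have key : ∀ n, ∃ g : BorelAut R, ∀ x y,
      (x, y) ∈ {p : X × X | p.1 ∈ φ.dom ∩ (W n ∩ f ⁻¹' (W n)ᶜ) ∧ f p.1 = p.2} → g x = y :=
      fun n => by
    refine (BorelAut.exists_of_graph ?_ ?_ ?_ ?_ ?_).imp fun g hg => hg.2
    · exact (measurable_fst (hdom.inter ((hWm n).inter (hfm (hWm n).compl)))).inter
        (measurableSet_eq_fun (hfm.comp measurable_fst) measurable_snd)
    · rintro ⟨x, y⟩ ⟨hx, (rfl : f x = y)⟩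
      exact φ.2.2 _ _ (hfdom hx.1)
    · rintro ⟨x, y⟩ ⟨hx, (rfl : f x = y)⟩ ⟨x', y'⟩ ⟨hx', (rfl : f x' = y')⟩ (rfl : x = x')
      rfl
    · rintro ⟨x, y⟩ ⟨hx, (rfl : f x = y)⟩ ⟨x', y'⟩ ⟨hx', (rfl : f x' = y')⟩ (h : f x = f x')
      obtain rfl := hinj hx.1 hx'.1 h
      rfl
    · rw [Set.disjoint_left]
      rintro _ ⟨⟨x, y⟩, ⟨hx, (rfl : f x = y)⟩, rfl⟩ ⟨⟨x', y'⟩, ⟨hx', (rfl : f x' = y')⟩, h⟩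
      exact hx'.2.2 ((show f x' = x from h) ▸ hx.2.1)
  choose g hg using key
  -- Piece `0` is the fixed-point set, where the identity serves; the other pieces have disjoint
  -- domain and range, so involutions serve.
  refine ⟨fun n => n.casesOn (φ.dom ∩ {x | f x = x}) fun n => φ.dom ∩ (W n ∩ f ⁻¹' (W n)ᶜ),
    fun n => n.casesOn 1 g, ?_, ?_, fun x hx => ?_⟩
  · rintro (_ | n)
    · exact hdom.inter (measurableSet_eq_fun hfm measurable_id)
    · exact hdom.inter ((hWm n).inter (hfm (hWm n).compl))
  · rintro (_ | n) x hx
    · rw [hfdom hx.1]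
      exact congrArg some hx.2
    · rw [hfdom hx.1]
      exact congrArg some (hg n x (f x) ⟨hx, rfl⟩).symm
  · by_cases h : f x = x
    · exact ⟨0, hx, h⟩
    · obtain ⟨n, hn⟩ := hW x (f x) (Ne.symm h)
      exact ⟨n + 1, hx, hn⟩

/-- The simple elements are dense in the full semigroup. -/
theorem BorelFullSemigroup.exists_isSimple_dist_lt [StandardBorelSpace X] [IsProbabilityMeasure μ]
    (φ : BorelFullSemigroup R) {δ : ℝ} (hδ : 0 < δ) :
    ∃ ψ : BorelFullSemigroup R, IsSimple R ψ.1 ∧ dist ψ φ < δ := by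
  obtain ⟨A, g, hA, hAg, hcov⟩ := φ.exists_pieces
  obtain ⟨M, hM⟩ := ((tendsto_measureReal_setOf_forall_lt_notMem (μ := μ) φ.measurableSet_dom hA
    (Eventually.of_forall hcov)).eventually (gt_mem_nhds hδ)).exists
  have hD : MeasurableSet (⋃ n : Fin M, A n) := MeasurableSet.iUnion fun n => hA n
  refine ⟨φ * idOn R hD, ⟨Option (Fin M), inferInstance,
    fun o => o.elim (⋃ n : Fin M, A n)ᶜ fun n => A n, fun o => o.elim none fun n => some (g n),
    ?_, fun x => ?_, ?_⟩, ?_⟩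
  · rintro (_ | n)
    exacts [hD.compl, hA n]
  · by_cases hx : x ∈ ⋃ n : Fin M, A n
    · obtain ⟨n, hn⟩ := Set.mem_iUnion.1 hx
      exact ⟨some n, hn⟩
    · exact ⟨none, hx⟩
  · rintro (_ | n) x hx
    · exact φ.mul_idOn_apply_of_notMem hD hx
    · exact (φ.mul_idOn_apply_of_mem hD (Set.mem_iUnion.2 ⟨n, hx⟩)).trans (hAg n x hx)
  · rw [dist_def]
    refine (measureReal_mono fun x hx => ?_).trans_lt hM
    have hxD : x ∉ ⋃ n : Fin M, A n := fun h => hx (φ.mul_idOn_apply_of_mem hD h)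
    refine ⟨?_, fun n hn hxn => hxD (Set.mem_iUnion.2 ⟨⟨n, hn⟩, hxn⟩)⟩
    have h : (φ * idOn R hD).1 x ≠ φ.1 x := hx
    rw [φ.mul_idOn_apply_of_notMem hD hxD] at h
    exact Option.isSome_iff_ne_none.2 h.symm

end Simple

/-! ### Partial bijections following simple elements -/

namespace SoficEmbedding

variable {X : Type*} [MeasurableSpace X] {μ : Measure X} [IsProbabilityMeasure μ]
  {R : MPEquivRel μ} {U : Ultrafilter ℕ} {n : ℕ → ℕ} (s : SoficEmbedding R U n)

/-- The sequence `F` of partial maps of the sets `Fin (n k)` follows `φ` if it asymptotically agrees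
with the action of an element of the full group wherever `φ` agrees with this element, and is
asymptotically undefined where `φ` is undefined. -/
def Follows (F : ∀ k, Fin (n k) → Option (Fin (n k))) (φ : X ≃. X) : Prop :=
  ∀ A : Set X, MeasurableSet A → ∀ c : Option (BorelAut R),
    (∀ x ∈ A, φ x = c.map fun g => g x) →
      ∀ᶠ p in conull U n, p ∈ s.region A → F p.1 p.2 = c.map fun g => s.toFun g p.1 p.2

theorem Follows.congr {F G : ∀ k, Fin (n k) → Option (Fin (n k))} {φ : X ≃. X}
    (hF : s.Follows F φ) (h : ∀ᶠ p in conull U n, F p.1 p.2 = G p.1 p.2) : s.Follows G φ := by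
  intro A hA c hc
  filter_upwards [hF A hA c hc, h] with p h1 h2 hp
  rw [← h2, h1 hp]

section

variable [StandardBorelSpace X] (hR : IsAperiodic R)
include hR

theorem follows_refl : s.Follows (fun _ => some) (PEquiv.refl X) := by
  intro A hA c hc
  filter_upwards [s.act_one, s.map_congr hR hA (c := some 1) hc] with p h1 h2 hp
  rw [← h2 hp]
  have h1 : s.act 1 p = ⟨p.1, p.2⟩ := h1
  simp only [act, Sigma.mk.injEq, heq_eq_eq, true_and] at h1
  simp [h1]

theorem follows_bot : s.Follows (fun _ _ => none) (⊥ : X ≃. X) := by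
  intro A hA c hc
  filter_upwards [s.map_congr hR hA (c := none) hc] with p h1 hp
  rw [← h1 hp]
  rfl

/-- One cover suffices: where two descriptions of `φ` overlap they agree, so the actions agree on
the region of the overlap. -/
theorem Follows.of_cover {F : ∀ k, Fin (n k) → Option (Fin (n k))} {φ : X ≃. X} {ι : Type*}
    [Finite ι] {A : ι → Set X} {c : ι → Option (BorelAut R)} (hA : ∀ i, MeasurableSet (A i))
    (hcov : ∀ x, ∃ i, x ∈ A i) (hφ : ∀ i, ∀ x ∈ A i, φ x = (c i).map fun g => g x)
    (hF : ∀ i, ∀ᶠ p in conull U n, p ∈ s.region (A i) →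
      F p.1 p.2 = (c i).map fun g => s.toFun g p.1 p.2) : s.Follows F φ := by
  intro B hB d hd
  refine s.eventually_of_cover hR hA hcov fun i => ?_
  filter_upwards [hF i, s.region_inter hR (hA i) hB, s.map_congr hR ((hA i).inter hB) (c := c i)
    (c' := d) fun x hx => by rw [← hφ i x hx.1, hd x hx.2]] with p h1 h2 h3 hpA hpB
  rw [h1 hpA, h3 (h2 hpA hpB)]

/-- Where `ψ` acts as `h`, the region of `h ⁻¹' A i` is carried into that of `A i`. There `F` acts
as the `i`-th element, and the product is asymptotically multiplicative. -/
theorem Follows.trans {F G : ∀ k, Fin (n k) → Option (Fin (n k))} {φ ψ : X ≃. X}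
    (hφs : IsSimple R φ) (hψs : IsSimple R ψ) (hF : s.Follows F φ) (hG : s.Follows G ψ) :
    s.Follows (fun k i => (G k i).bind (F k)) (ψ.trans φ) := by
  obtain ⟨ι, _, A, c, hA, hAcov, hφ⟩ := hφs
  obtain ⟨κ, _, B, d, hB, hBcov, hψ⟩ := hψs
  intro C hC e he
  refine s.eventually_of_cover hR hB hBcov fun j => ?_
  rcases hd : d j with _ | h
  · have hzero : ∀ x ∈ B j ∩ C, (none : Option (BorelAut R)).map (fun g => g x) =
        e.map fun g => g x := fun x hx => by
      rw [← he x hx.2]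
      change none = (ψ x).bind φ
      rw [hψ j x hx.1, hd]
      rfl
    filter_upwards [hG (B j) (hB j) (d j) (hψ j), s.region_inter hR (hB j) hC,
      s.map_congr hR ((hB j).inter hC) hzero] with p h1 h2 h3 hpB hpC
    rw [h1 hpB, hd, ← h3 (h2 hpB hpC)]
    rfl
  · have hAm : ∀ i, MeasurableSet ((h : X → X) ⁻¹' A i) := fun i => h.measurable (hA i)
    refine s.eventually_of_cover hR hAm (fun x => hAcov (h x)) fun i => ?_
    have hcomb : ∀ x ∈ (h : X → X) ⁻¹' A i ∩ (B j ∩ C),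
        ((c i).map fun g => g * h).map (fun g => g x) = e.map fun g => g x := fun x hx => by
      rw [← he x hx.2.2]
      change _ = (ψ x).bind φ
      rw [hψ j x hx.2.1, hd]
      have h1 := hφ i (h x) hx.1
      simp only [Option.map_some, Option.bind_some, h1, Option.map_map]
      rfl
    have hmul : ∀ᶠ p in conull U n, ∀ g ∈ c i,
        s.toFun (g * h) p.1 p.2 = s.toFun g p.1 (s.toFun h p.1 p.2) := by
      rcases c i with _ | g
      · simp
      · filter_upwards [s.act_mul g h] with p hp g' hg'
        obtain rfl : g = g' := by simpa using hg'
        exact eq_of_heq (Sigma.mk.inj_iff.1 hp).2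
    filter_upwards [hG (B j) (hB j) (d j) (hψ j), s.region_inter hR (hB j) hC,
      s.region_inter hR (hAm i) ((hB j).inter hC), s.act_mem_region hR (hA i) h,
      (s.tendsto_act h).eventually (hF (A i) (hA i) (c i) (hφ i)), hmul,
      s.map_congr hR ((hAm i).inter ((hB j).inter hC)) hcomb]
      with p h1 h2 h3 h4 h5 h6 h7 hpA hpB hpC
    rw [← h7 (h3 hpA (h2 hpB hpC)), h1 hpB, hd]
    have h8 : F p.1 (s.toFun h p.1 p.2) =
      (c i).map fun g => s.toFun g p.1 (s.toFun h p.1 p.2) := h5 (h4 hpA)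
    simp only [Option.map_some, Option.bind_some, h8, Option.map_map]
    exact Option.map_congr fun g hg => (h6 g hg).symm

theorem exists_follows {φ : X ≃. X} (hφ : IsSimple R φ) :
    ∃ F : ∀ k, Fin (n k) → Option (Fin (n k)), s.Follows F φ := by
  classical
  obtain ⟨ι, _, A, c, hA, hcov, hφ⟩ := hφ
  refine ⟨fun k i => if h : ∃ j, (⟨k, i⟩ : Σ k, Fin (n k)) ∈ s.region (A j) then
    (c h.choose).map fun g => s.toFun g k i else none, ?_⟩
  refine Follows.of_cover s hR hA hcov hφ fun i => ?_
  have hcongr : ∀ᶠ p in conull U n, ∀ j, p ∈ s.region (A i) → p ∈ s.region (A j) →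
      (c j).map (fun g => s.toFun g p.1 p.2) = (c i).map fun g => s.toFun g p.1 p.2 := by
    rw [eventually_all]
    intro j
    filter_upwards [s.region_inter hR (hA i) (hA j), s.map_congr hR ((hA i).inter (hA j))
      (c := c j) (c' := c i) fun x hx => by rw [← hφ j x hx.2, ← hφ i x hx.1]] with p h1 h2 h3 h4
    exact h2 (h1 h3 h4)
  filter_upwards [hcongr] with p hp hpi
  have h : ∃ j, (⟨p.1, p.2⟩ : Σ k, Fin (n k)) ∈ s.region (A j) := ⟨i, hpi⟩
  rw [dif_pos h]
  exact hp _ hpi h.choose_spec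

/-- The set where `F` and `G` differ is asymptotically the region of `{φ ≠ ψ}`, by comparing group
elements on each common piece. -/
theorem hasDensity_ne {F G : ∀ k, Fin (n k) → Option (Fin (n k))} {φ ψ : X ≃. X}
    (hφs : IsSimple R φ) (hψs : IsSimple R ψ) (hF : s.Follows F φ) (hG : s.Follows G ψ) :
    HasDensity U {p | F p.1 p.2 ≠ G p.1 p.2} (μ.real {x | φ x ≠ ψ x}) := by
  have hD := hφs.measurableSet_ne hψs
  refine (s.hasDensity_region hR hD).congr ?_
  obtain ⟨ι, _, A, c, hA, hAcov, hφ⟩ := hφs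
  obtain ⟨κ, _, B, d, hB, hBcov, hψ⟩ := hψs
  refine s.eventually_of_cover hR hA hAcov fun i => s.eventually_of_cover hR hB hBcov fun j => ?_
  have hC := (hA i).inter (hB j)
  filter_upwards [hF (A i) (hA i) (c i) (hφ i), hG (B j) (hB j) (d j) (hψ j),
    s.region_inter hR (hA i) (hB j), s.region_inter hR hC hD, s.region_inter hR hC hD.compl,
    s.region_disjoint hR hD hD.compl disjoint_compl_right, s.mem_region_or_compl hR hD,
    s.map_ne hR (hC.inter hD) (c := c i) (c' := d j) fun x hx => by
      rw [← hφ i x hx.1.1, ← hψ j x hx.1.2]; exact hx.2,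
    s.map_congr hR (hC.inter hD.compl) (c := c i) (c' := d j) fun x hx => by
      rw [← hφ i x hx.1.1, ← hψ j x hx.1.2]; exact not_not.1 hx.2]
    with p h1 h2 h3 h4 h5 h6 h7 h8 h9 hpB hpA
  rw [h1 hpA, h2 hpB]
  have hpC := h3 hpA hpB
  rcases h7 with h | h
  · exact iff_of_true h (h8 (h4 hpC h))
  · exact iff_of_false (fun h' => h6 h' h) (not_not.2 (h9 (h5 hpC h)))

/-- With `G` following the inverse of `φ`, restricting `F` to the points where `G` undoes it gives a
partial bijection. Almost no point is lost, since `F` followed by `G` follows the identity of the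
domain. -/
theorem exists_pequiv_follows {φ : X ≃. X} (hφ : IsSimple R φ) :
    ∃ F : ∀ k, Fin (n k) ≃. Fin (n k), s.Follows (fun k => F k) φ := by
  classical
  obtain ⟨F, hF⟩ := s.exists_follows hR hφ
  obtain ⟨G, hG⟩ := s.exists_follows hR hφ.symm
  have hGF := Follows.trans s hR hφ.symm hφ hG hF
  have hinv : ∀ᶠ p in conull U n, ∀ j, F p.1 p.2 = some j → G p.1 j = some p.2 := by
    obtain ⟨ι, _, A, c, hA, hcov, hφ⟩ := hφ
    refine s.eventually_of_cover hR hA hcov fun i => ?_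
    rcases hc : c i with _ | g
    · filter_upwards [hF (A i) (hA i) (c i) (hφ i)] with p h1 hp j hj
      rw [h1 hp, hc] at hj
      cases hj
    · have h1 : ∀ x ∈ A i, φ.trans φ.symm x = (some (1 : BorelAut R)).map fun g => g x :=
        fun x hx => by
          have h2 : φ x = some (g x) := by rw [hφ i x hx, hc]; rfl
          change (φ x).bind φ.symm = some x
          rw [h2]
          exact φ.eq_some_iff.2 h2
      filter_upwards [hGF (A i) (hA i) _ h1, s.act_one] with p h2 h3 hp j hj
      have h4 := h2 hp
      rw [hj] at h4
      have h3 : s.act 1 p = ⟨p.1, p.2⟩ := h3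
      simp only [act, Sigma.mk.injEq, heq_eq_eq, true_and] at h3
      simpa [h3] using h4
  let H : ∀ k, Fin (n k) ≃. Fin (n k) := fun k =>
    { toFun := fun i => if (F k i).bind (G k) = some i then F k i else none
      invFun := fun j => if (G k j).bind (F k) = some j then G k j else none
      inv := fun i j => by
        have key : ∀ (f g : Fin (n k) → Option (Fin (n k))) i j,
            (j ∈ if (f i).bind g = some i then f i else none) ↔ f i = some j ∧ g j = some i :=
          fun f g i j => by
            rw [Option.mem_def]
            constructor
            · intro h
              split_ifs at h with h1
              rw [h] at h1
              exact ⟨h, h1⟩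
            · rintro ⟨h1, h2⟩
              rw [if_pos (by rw [h1]; exact h2), h1]
        exact (key _ _ _ _).trans (and_comm.trans (key _ _ _ _).symm) }
  refine ⟨H, hF.congr s ?_⟩
  filter_upwards [hinv] with p hp
  change F p.1 p.2 = if (F p.1 p.2).bind (G p.1) = some p.2 then F p.1 p.2 else none
  split_ifs with h
  · rfl
  · rcases hFp : F p.1 p.2 with _ | j
    · rfl
    · rw [hFp] at h
      exact (h (hp j hFp)).elim

/-- Every element of the full semigroup is close to a simple element that is followed by partial
bijections; for the identity and the empty map these are the obvious ones. -/
theorem exists_approx (φ : FullSemigroup R) {δ : ℝ} (hδ : 0 < δ) :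
    ∃ (ψ : BorelFullSemigroup R) (F : ∀ k, Fin (n k) ≃. Fin (n k)), IsSimple R ψ.1 ∧
      s.Follows (fun k => F k) ψ.1 ∧ dist (SeparationQuotient.mk ψ) φ < δ ∧
      (φ = 1 → ψ = 1 ∧ ∀ k, F k = PEquiv.refl _) ∧
      (φ = SeparationQuotient.mk 0 → ∀ k, F k = ⊥) := by
  -- The exact requirements at the identity and at the empty map do not conflict, since these are at
  -- distance `1`.
  have hne : (1 : FullSemigroup R) ≠ SeparationQuotient.mk 0 := fun h => by
    have h1 : dist (1 : BorelFullSemigroup R) 0 = 0 := by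
      rw [← SeparationQuotient.dist_mk]
      exact dist_eq_zero.2 h
    rw [BorelFullSemigroup.dist_def] at h1
    have : {x | (1 : BorelFullSemigroup R).1 x ≠ (0 : BorelFullSemigroup R).1 x} = Set.univ :=
      Set.eq_univ_of_forall fun x => Option.some_ne_none x
    simp [this] at h1
  by_cases h1 : φ = 1
  · subst h1
    refine ⟨1, fun k => PEquiv.refl _, isSimple_refl, s.follows_refl hR, ?_,
      fun _ => ⟨rfl, fun _ => rfl⟩, fun h => (hne h).elim⟩
    rwa [SeparationQuotient.mk_one, dist_self]
  by_cases h0 : φ = SeparationQuotient.mk 0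
  · subst h0
    exact ⟨0, fun k => ⊥, isSimple_bot, s.follows_bot hR, by rwa [dist_self],
      fun h => (h1 h).elim, fun _ _ => rfl⟩
  obtain ⟨φ, rfl⟩ := SeparationQuotient.surjective_mk φ
  obtain ⟨ψ, hψ, hd⟩ := φ.exists_isSimple_dist_lt hδ
  obtain ⟨F, hF⟩ := s.exists_pequiv_follows hR hψ
  exact ⟨ψ, F, hψ, hF, by rwa [SeparationQuotient.dist_mk], fun h => (h1 h).elim,
    fun h => (h0 h).elim⟩

theorem tendsto_normHamming (F G : ∀ k, Fin (n k) ≃. Fin (n k)) (φ ψ : BorelFullSemigroup R)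
    (hφ : IsSimple R φ.1) (hψ : IsSimple R ψ.1) (hF : s.Follows (fun k => F k) φ.1)
    (hG : s.Follows (fun k => G k) ψ.1) :
    Tendsto (fun k => normHamming (F k) (G k)) U (𝓝 (dist φ ψ)) := by
  rw [BorelFullSemigroup.dist_def]
  have h := s.hasDensity_ne hR hφ hψ hF hG
  have e : (fun k => normHamming (F k) (G k)) = density {p | F p.1 p.2 ≠ G p.1 p.2} :=
    funext fun k => (density_ne (β := fun k => Option (Fin (n k))) (fun k => ⇑(F k))
      (fun k => ⇑(G k)) k).symm
  rw [e]
  exact h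

/-- Each `φ` is replaced by a simple `q φ` within `ε / 3`. The multiplicative error tends to `d(q
(φψ), q φ * q ψ) < 3 * (ε / 3)`, and traces are distances to the identity. Finitely many conditions
along `U` hold at a common index `k`. -/
theorem isSofic (s : SoficEmbedding R U n) : IsSofic R := by
  intro K ε hε
  choose q F hq hF hd hone hzero using fun φ : FullSemigroup R =>
    s.exists_approx hR φ (δ := ε / 3) (by positivity)
  have hmul : ∀ φ ∈ K, ∀ ψ ∈ K, ∀ᶠ k in (U : Filter ℕ),
      normHamming (F (φ * ψ) k) ((F ψ k).trans (F φ k)) < ε := fun φ _ ψ _ => by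
    have hFm : s.Follows (fun k => (F ψ k).trans (F φ k)) (q φ * q ψ).1 :=
      Follows.trans s hR (hq φ) (hq ψ) (hF φ) (hF ψ)
    have h1 := s.tendsto_normHamming hR (F (φ * ψ)) (fun k => (F ψ k).trans (F φ k))
      (q (φ * ψ)) (q φ * q ψ) (hq (φ * ψ)) ((hq φ).trans (hq ψ)) (hF (φ * ψ)) hFm
    refine h1.eventually (gt_mem_nhds ?_)
    obtain ⟨φ', hφ'⟩ := SeparationQuotient.surjective_mk φ
    obtain ⟨ψ', hψ'⟩ := SeparationQuotient.surjective_mk ψ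
    have d1 := hd (φ * ψ)
    have d2 := hd φ
    have d3 := hd ψ
    have e : φ * ψ = SeparationQuotient.mk (φ' * ψ') := by
      rw [← hφ', ← hψ']
      rfl
    nth_rw 2 [e] at d1
    nth_rw 2 [← hφ'] at d2
    nth_rw 2 [← hψ'] at d3
    rw [SeparationQuotient.dist_mk] at d1 d2 d3
    have d4 := BorelFullSemigroup.dist_mul_le φ' (q φ) ψ' (q ψ)
    have d5 := dist_triangle (q (φ * ψ)) (φ' * ψ') (q φ * q ψ)
    rw [dist_comm φ', dist_comm ψ'] at d4
    linarith
  have htr : ∀ φ ∈ K, ∀ᶠ k in (U : Filter ℕ),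
      |FullSemigroup.trace φ - finTrace (F φ k)| < ε := fun φ _ => by
    have h1 := s.tendsto_normHamming hR (F φ) (fun _ => PEquiv.refl _) (q φ) 1 (hq φ)
      isSimple_refl (hF φ) (s.follows_refl hR)
    have h2 : Tendsto (fun k => finTrace (F φ k)) U (𝓝 (q φ).trace) := by
      have h3 := h1.const_sub 1
      rw [show (q φ).trace = 1 - dist (q φ) 1 from
        FullSemigroup.trace_mk (q φ) ((hq φ).measurableSet_ne isSimple_refl)]
      refine h3.congr fun k => ?_
      rw [normHamming_refl (s.pos k)]
      ring
    have h3 := (h2.const_sub (FullSemigroup.trace φ)).abs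
    refine h3.eventually (gt_mem_nhds ?_)
    obtain ⟨φ', hφ'⟩ := SeparationQuotient.surjective_mk φ
    have d2 := hd φ
    nth_rw 2 [← hφ'] at d2
    rw [SeparationQuotient.dist_mk] at d2
    have t1 := BorelFullSemigroup.trace_sub_le (q φ) φ'
    have t2 := BorelFullSemigroup.trace_sub_le φ' (q φ)
    rw [dist_comm] at t2
    rw [show FullSemigroup.trace φ = φ'.trace from hφ' ▸ rfl, abs_lt]
    constructor <;> linarith
  have hall : ∀ᶠ k in (U : Filter ℕ),
      (∀ φ ∈ K, ∀ ψ ∈ K, normHamming (F (φ * ψ) k) ((F ψ k).trans (F φ k)) < ε) ∧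
        ∀ φ ∈ K, |FullSemigroup.trace φ - finTrace (F φ k)| < ε := by
    refine Eventually.and ?_ ?_
    · exact (eventually_all_finset K).2 fun φ hφ => (eventually_all_finset K).2 (hmul φ hφ)
    · exact (eventually_all_finset K).2 htr
  obtain ⟨k, hk⟩ := hall.exists
  exact ⟨n k, s.pos k, fun φ => F φ k, (hone 1 rfl).2 k, hzero _ rfl k, hk⟩

end

end SoficEmbedding

end SoficRel

theorem mainTheorem1 {X : Type*} [MeasurableSpace X] [StandardBorelSpace X]
    (μ : MeasureTheory.Measure X) [MeasureTheory.IsProbabilityMeasure μ]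
    (R : SoficRel.MPEquivRel μ) (hR : SoficRel.IsAperiodic R)
    (U : Ultrafilter ℕ) (hU : (U : Filter ℕ) ≤ Filter.cofinite) :
    SoficRel.IsSofic R ↔
      ∃ n : ℕ → ℕ, (∀ k, 0 < n k) ∧
        ∃ θ : SoficRel.FullGroup R →* SoficRel.SymUltraproduct U n, Isometry θ := by
  refine ⟨fun h => h.exists_isometry U hU, ?_⟩
  rintro ⟨n, hn, θ, hθ⟩
  obtain ⟨s⟩ := SoficRel.SoficEmbedding.nonempty_of_isometry hn hθ
  exact s.isSofic hR
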